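/- **Definitions.** A *commutative regular quasi-semiring* (cr-qsring) is an algebra $(R,+,\bullet,-,{}^{-1},\varepsilon)$ of signature $(2,2,1,1,0)$ such that $(R,+)$ and $(R,\bullet)$ are commutative regular semigroups with quasi-inverses $-x$ and $x^{-1}$ (i.e. $x+(-x)+x=x$, $(-x)+x+(-x)=-x$, and likewise for $\bullet$), such that $\varepsilon$ is the only element idempotent for both operations, and such that, writing $e^+(x)=x+(-x)$ and $x\le y\iff x=y+e^+(x)$, for all $x,y,z\in R$: $x\bullet y+x\bullet z\le x\bullet(y+z)$; $y\le z\Rightarrow x\bullet y\le x\bullet z$; $-(x\bullet y)=x\bullet(-y)$; and $e^+(x+y)\le e^+(x\bullet y)$ whenever $x\bullet x=x$ and $y\bullet y=y$. Let $\Lambda=\{x\in R: x+x=x\}$; it is an Abelian $l$-group under $\bullet$ with neutral element $\varepsilon$, order $\le$ and meet $+$. Put $\Lambda_+=\{\alpha\in\Lambda:\alpha\ge\varepsilon\}$ and $v(x)=\varepsilon\bullet x\in\Lambda$. $R$ is *directed* if $\varepsilon\le x$ whenever $x\bullet x=x$; then any two elements have a meet $x\wedge y=x+v(x-y)$. A directed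 $R$ is *superrigid* if for every $\alpha\in\Lambda_+$ there is a (necessarily unique) $1_\alpha\in R$ with $1_\alpha\bullet 1_\alpha=1_\alpha$ and $e^+(1_\alpha)=\alpha$. $R$ is *complete* if for every $x\in R$ there is a map $\varphi:\Lambda\to R$ with $e^+(\varphi(\alpha))=\alpha$ for all $\alpha$, $\varphi(\alpha)\le\varphi(\beta)$ for $\alpha\le\beta$, and $\varphi(e^+(x))=x$. $\widehat\Lambda$ is the set of maps $\theta:\Lambda_+\to\Lambda$ with $\theta(\alpha)=\theta(\beta)\wedge\alpha$ for $\alpha\le\beta$, ordered pointwise, with last element $\alpha\mapsto\alpha$; it is a commutative monoid under $(\theta\zeta)(\alpha)=\bigl(\theta(\alpha\zeta(\varepsilon)^{-1})\,\zeta(\alpha\theta(\varepsilon)^{-1})\bigr)\wedge\alpha$, and $\Lambda$ is embedded in it by $\gamma\mapsto(\alpha\mapsto\gamma\wedge\alpha)$. For $R$ superrigid and directed, $B=B(R)$ is the set of maps $\varphi:\Lambda_+\to R$ with $e^+(\varphi(\alpha))=\alpha$ and $\varphi(\alpha)\le\varphi(\beta)$ for $\alpha\le\beta$; it is a commutative ring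 under pointwise addition and $(\varphi\cdot\psi)(\alpha)=\varphi(\alpha\bullet v(\psi(\varepsilon))^{-1})\bullet\psi(\alpha\bullet v(\varphi(\varepsilon))^{-1})+\alpha$, with unit $\alpha\mapsto1_\alpha$. Let $w:B\to\widehat\Lambda$, $w(\varphi)=v\circ\varphi$, and let $A=\{\varphi\in B: w(\varphi)\ge\varepsilon\}$, a subring of $B$. Let $M$ be the multiplicative monoid of finitely generated $A$-submodules of $B$, with group of invertible elements $M^*$, and let $\widehat w:M\to\widehat\Lambda$ be given by $\widehat w(I)=\bigwedge_i w(\varphi_i)$ for any finite system of generators $(\varphi_i)$ of $I$ (the value does not depend on the system). $R$ is *Prüfer* if $A\subseteq B$ is a Prüfer extension, i.e. every $I\in M$ with $IB=B$ is invertible. $R$ is *Prüfer–Manis in the strong sense* if it is Prüfer, the group $\widehat w(M)^*$ of invertible elements of the monoid $\widehat w(M)$ equals $\Lambda$, and $\widehat w$ restricts to an isomorphism of ordered groups $M^*\to\Lambda$, where $I\le J\iff J\subseteq I$ on $M^*$. For $R$ directed put $d(x,y)=\dfrac{e^+(x)\bullet e^+(y)}{e^+(x\wedge y)^2}\in\Lambda_+$,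 and let $[x,y]$ be the set of all $z\ge x\wedge y$ such that $z$ is the join of $x\wedge z$ and $y\wedge z$. $R$ is *locally faithfully full* if for all $x,y\in R$ the map $z\mapsto d(x,z)$ is a bijection from $[x,y]$ onto $\{\gamma\in\Lambda:\varepsilon\le\gamma\le d(x,y)\}$, and *median* if for all $x,y,z\in R$ the set $[x,y]\cap[y,z]\cap[z,x]$ consists of a single element. **Lemma 6.11.** Let $R$ be a complete superrigid directed cr-qsring such that for every $\gamma\in\Lambda$ there is $I\in M^*$ with $\widehat w(I)=\gamma$. Then $R$ is Prüfer–Manis in the strong sense and locally faithfully full, and hence median. -/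

import Mathlib

/-! Commutative regular quasi-semirings, their associated ring, and the value map on finitely
generated submodules. -/

namespace CRQ

/-! ### The extension of an Abelian lattice-ordered group to a lattice-ordered monoid -/

/-- The monoid of nonnegative elements `α ≥ 1` of a (multiplicative) Abelian lattice-ordered
group. -/
abbrev Pos (Λ : Type*) [CommGroup Λ] [Lattice Λ] [IsOrderedMonoid Λ] : Type _ :=
  Submonoid.oneLE Λ

/-- The inverse limit of the down-sets of the nonnegative elements, i.e. the set of all maps
`φ : Λ₊ → Λ` with `φ α = φ β ⊓ α` for `α ≤ β`. -/
structure LHat (Λ : Type*) [CommGroup Λ] [Lattice Λ] [IsOrderedMonoid Λ] where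
  /-- the underlying map -/
  toFun : Pos Λ → Λ
  compat' : ∀ α β : Pos Λ, α ≤ β → toFun α = toFun β ⊓ (α : Λ)

namespace LHat

variable {Λ : Type*} [CommGroup Λ] [Lattice Λ] [IsOrderedMonoid Λ]

instance : CoeFun (LHat Λ) (fun _ => Pos Λ → Λ) := ⟨LHat.toFun⟩

theorem ext {φ ψ : LHat Λ} (h : ∀ α, φ α = ψ α) : φ = ψ := by
  cases φ; cases ψ; congr; exact funext h

theorem compat (φ : LHat Λ) {α β : Pos Λ} (h : α ≤ β) : φ α = φ β ⊓ (α : Λ) :=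
  φ.compat' α β h

theorem mono (φ : LHat Λ) {α β : Pos Λ} (h : α ≤ β) : φ α ≤ φ β := by
  rw [φ.compat h]; exact inf_le_left

theorem le_self (φ : LHat Λ) (α : Pos Λ) : φ α ≤ (α : Λ) := by
  rw [φ.compat le_rfl]; exact inf_le_right

theorem one_le (α : Pos Λ) : (1 : Pos Λ) ≤ α := α.2

/-- The element `φ₋ = (φ 1)⁻¹` of `Λ₊`. -/
def minus (φ : LHat Λ) : Pos Λ :=
  ⟨(φ 1)⁻¹, by
    have h := φ.le_self 1
    simpa using h⟩

/-- The pointwise partial order. -/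
instance : PartialOrder (LHat Λ) where
  le φ ψ := ∀ α, φ α ≤ ψ α
  le_refl φ α := le_rfl
  le_trans φ ψ χ h₁ h₂ α := (h₁ α).trans (h₂ α)
  le_antisymm φ ψ h₁ h₂ := ext fun α => le_antisymm (h₁ α) (h₂ α)

theorem le_def {φ ψ : LHat Λ} : φ ≤ ψ ↔ ∀ α, φ α ≤ ψ α := Iff.rfl

/-- The pointwise meet. -/
instance : SemilatticeInf (LHat Λ) where
  inf φ ψ := ⟨fun α => φ α ⊓ ψ α, fun α β h => by
    show φ α ⊓ ψ α = φ β ⊓ ψ β ⊓ (α : Λ)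
    rw [φ.compat h, ψ.compat h, inf_inf_inf_comm, inf_idem]⟩
  inf_le_left φ ψ := fun _ => inf_le_left
  inf_le_right φ ψ := fun _ => inf_le_right
  le_inf φ ψ χ h₁ h₂ := fun α => le_inf (h₁ α) (h₂ α)

theorem inf_apply (φ ψ : LHat Λ) (α : Pos Λ) : (φ ⊓ ψ) α = φ α ⊓ ψ α := rfl

/-- The last element, given by the inclusion `Λ₊ → Λ`. -/
instance : OrderTop (LHat Λ) where
  top := ⟨fun α => (α : Λ), fun _ _ h => (inf_eq_right.2 h).symm⟩
  le_top φ := fun α => φ.le_self α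

theorem top_apply (α : Pos Λ) : (⊤ : LHat Λ) α = (α : Λ) := rfl

/-- The embedding of `Λ`, sending `γ` to `α ↦ γ ⊓ α`. -/
def embed (γ : Λ) : LHat Λ :=
  ⟨fun α => γ ⊓ (α : Λ), fun α β h => by
    rw [inf_assoc, inf_eq_right.2 (show (α : Λ) ≤ β from h)]⟩

theorem mul_aux (φ ψ : LHat Λ) (α γ : Pos Λ) (h₁ : α * ψ.minus ≤ γ) (h₂ : α * φ.minus ≤ γ) :
    (φ (α * ψ.minus) * ψ (α * φ.minus)) ⊓ (α : Λ) = (φ γ * ψ γ) ⊓ (α : Λ) := by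
  apply le_antisymm
  · exact inf_le_inf_right _ (mul_le_mul' (φ.mono h₁) (ψ.mono h₂))
  · refine le_inf ?_ inf_le_right
    rw [φ.compat h₁, ψ.compat h₂, mul_inf, inf_mul, inf_mul]
    have e1 : φ 1 ≤ φ γ := φ.mono (one_le γ)
    have e2 : ψ 1 ≤ ψ γ := ψ.mono (one_le γ)
    have m1 : ((φ.minus : Pos Λ) : Λ) = (φ 1)⁻¹ := rfl
    have m2 : ((ψ.minus : Pos Λ) : Λ) = (ψ 1)⁻¹ := rfl
    simp only [Submonoid.coe_mul, m1, m2]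
    have f1 : (1 : Λ) ≤ φ γ * (φ 1)⁻¹ := by rwa [← div_eq_mul_inv, one_le_div']
    have f2 : (1 : Λ) ≤ (ψ 1)⁻¹ * ψ γ := by
      rw [mul_comm]; rwa [← div_eq_mul_inv, one_le_div']
    have g1 : (1 : Λ) ≤ (φ 1)⁻¹ := φ.minus.2
    have g2 : (1 : Λ) ≤ (ψ 1)⁻¹ := ψ.minus.2
    have ha : (1 : Λ) ≤ (α : Λ) := α.2
    refine le_inf (le_inf inf_le_left ?_) (le_inf ?_ ?_)
    · refine inf_le_right.trans ?_
      rw [mul_assoc]; exact le_mul_of_one_le_right' f2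
    · refine inf_le_right.trans ?_
      rw [mul_left_comm]; exact le_mul_of_one_le_right' f1
    · refine inf_le_right.trans ?_
      calc (α : Λ) ≤ α * ((ψ 1)⁻¹ * (α * (φ 1)⁻¹)) :=
            le_mul_of_one_le_right' (one_le_mul g2 (one_le_mul ha g1))
        _ = α * (ψ 1)⁻¹ * (α * (φ 1)⁻¹) := by rw [mul_assoc]

/-- The product `(φ ψ) α = φ (α ψ₋) ψ (α φ₋) ⊓ α`. -/
instance : Mul (LHat Λ) where
  mul φ ψ := ⟨fun α => (φ (α * ψ.minus) * ψ (α * φ.minus)) ⊓ (α : Λ), fun α β h => by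
    have k1 : ∀ x : Pos Λ, α * x ≤ β * x := fun x => mul_le_mul_left h x
    have k2 : β * ψ.minus ≤ β * ψ.minus * φ.minus := le_mul_of_one_le_right' (one_le _)
    have k3 : β * φ.minus ≤ β * ψ.minus * φ.minus := by
      rw [mul_right_comm]; exact le_mul_of_one_le_right' (one_le _)
    rw [mul_aux φ ψ α (β * ψ.minus * φ.minus) ((k1 _).trans k2) ((k1 _).trans k3),
      mul_aux φ ψ β (β * ψ.minus * φ.minus) k2 k3, inf_assoc,
      inf_eq_right.2 (show (α : Λ) ≤ β from h)]⟩

theorem mul_apply (φ ψ : LHat Λ) (α γ : Pos Λ) (h₁ : α * ψ.minus ≤ γ) (h₂ : α * φ.minus ≤ γ) :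
    (φ * ψ) α = (φ γ * ψ γ) ⊓ (α : Λ) := mul_aux φ ψ α γ h₁ h₂

theorem mul_apply' (φ ψ : LHat Λ) (α : Pos Λ) :
    ∃ γ₀ : Pos Λ, α ≤ γ₀ ∧ ∀ γ, γ₀ ≤ γ → (φ * ψ) α = (φ γ * ψ γ) ⊓ (α : Λ) := by
  refine ⟨α * ψ.minus * φ.minus, ?_, fun γ h => mul_apply φ ψ α γ ?_ ?_⟩
  · exact (le_mul_of_one_le_right' (one_le _)).trans (le_mul_of_one_le_right' (one_le _))
  · exact (le_mul_of_one_le_right' (one_le _)).trans h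
  · rw [mul_right_comm] at h
    exact (le_mul_of_one_le_right' (one_le _)).trans h

protected theorem mul_comm (φ ψ : LHat Λ) : φ * ψ = ψ * φ := by
  apply ext; intro α
  obtain ⟨γ₁, -, h₁⟩ := mul_apply' φ ψ α
  obtain ⟨γ₂, -, h₂⟩ := mul_apply' ψ φ α
  rw [h₁ (γ₁ * γ₂) (le_mul_of_one_le_right' (one_le _)),
    h₂ (γ₁ * γ₂) (le_mul_of_one_le_left' (one_le _)), mul_comm (φ _)]

theorem mul_mul_apply (φ ψ χ : LHat Λ) (α : Pos Λ) :
    ∃ γ₀ : Pos Λ, ∀ γ, γ₀ ≤ γ → (φ * ψ * χ) α = (φ γ * ψ γ * χ γ) ⊓ (α : Λ) := by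
  obtain ⟨η, hη⟩ : ∃ η, η = α * χ.minus * (φ * ψ).minus := ⟨_, rfl⟩
  have h5 : α * χ.minus ≤ η := hη ▸ le_mul_of_one_le_right' (one_le _)
  have h6 : α * (φ * ψ).minus ≤ η := by
    rw [hη, mul_right_comm]; exact le_mul_of_one_le_right' (one_le _)
  obtain ⟨δ, hδ, h₂⟩ := mul_apply' φ ψ η
  refine ⟨δ, fun γ hγ => ?_⟩
  have h7 : (φ * ψ) η = φ γ * ψ γ ⊓ (η : Λ) := h₂ γ hγ
  rw [mul_apply (φ * ψ) χ α η h5 h6]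
  have hq : (α : Λ) ≤ χ η * η := by
    have q2 : (α : Λ) * (χ 1)⁻¹ ≤ η := h5
    calc (α : Λ) = χ 1 * (α * (χ 1)⁻¹) := by rw [mul_left_comm]; simp
      _ ≤ χ η * η := mul_le_mul' (χ.mono (one_le _)) q2
  have hr : (α : Λ) ≤ (φ * ψ) η * η := by
    have q2 : (α : Λ) * ((φ * ψ) 1)⁻¹ ≤ η := h6
    calc (α : Λ) = (φ * ψ) 1 * (α * ((φ * ψ) 1)⁻¹) := by rw [mul_left_comm]; simp
      _ ≤ (φ * ψ) η * η := mul_le_mul' ((φ * ψ).mono (one_le _)) q2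
  have hη' : χ η = χ γ ⊓ (η : Λ) := χ.compat (hδ.trans hγ)
  apply le_antisymm
  · refine inf_le_inf_right _ (mul_le_mul' ?_ ?_)
    · rw [h7]; exact inf_le_left
    · rw [hη']; exact inf_le_left
  · refine le_inf ?_ inf_le_right
    rw [h7, inf_mul]
    refine le_inf ?_ ?_
    · rw [hη', mul_inf]
      refine le_inf inf_le_left (inf_le_right.trans (hr.trans ?_))
      rw [h7]
      exact mul_le_mul_left inf_le_left _
    · rw [mul_comm (η : Λ)]; exact inf_le_right.trans hq

/-- The commutative monoid structure; the neutral element is the image of `1 ∈ Λ`. -/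
instance : CommMonoid (LHat Λ) where
  one := embed 1
  mul_comm := LHat.mul_comm
  mul_assoc φ ψ χ := by
    apply ext; intro α
    obtain ⟨γ₁, h₁⟩ := mul_mul_apply φ ψ χ α
    obtain ⟨γ₂, h₂⟩ := mul_mul_apply ψ χ φ α
    rw [LHat.mul_comm φ (ψ * χ), h₁ (γ₁ * γ₂) (le_mul_of_one_le_right' (one_le _)),
      h₂ (γ₁ * γ₂) (le_mul_of_one_le_left' (one_le _)), mul_assoc, mul_comm (φ _)]
  one_mul φ := by
    apply ext; intro α
    obtain ⟨γ, hγ, h⟩ := mul_apply' (embed 1) φ α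
    have e : ((embed 1 : LHat Λ) * φ) α = (embed 1 : LHat Λ) γ * φ γ ⊓ (α : Λ) := h γ le_rfl
    have e1 : (embed 1 : LHat Λ) γ = 1 := inf_eq_left.2 γ.2
    rw [e1, one_mul, ← φ.compat hγ] at e
    exact e
  mul_one φ := by
    rw [LHat.mul_comm]
    apply ext; intro α
    obtain ⟨γ, hγ, h⟩ := mul_apply' (embed 1) φ α
    have e : ((embed 1 : LHat Λ) * φ) α = (embed 1 : LHat Λ) γ * φ γ ⊓ (α : Λ) := h γ le_rfl
    have e1 : (embed 1 : LHat Λ) γ = 1 := inf_eq_left.2 γ.2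
    rw [e1, one_mul, ← φ.compat hγ] at e
    exact e

end LHat

/-! ### Commutative regular quasi-semirings -/

/-- The canonical partial order of a commutative regular additive semigroup:
`x ≤ y` if and only if `x = y + (x + (-x))`. -/
def CanonLE {R : Type*} [Add R] [Neg R] (x y : R) : Prop := x = y + (x + -x)

/-- Commutative regular quasi-semirings. -/
class CRQSRing (R : Type*) extends AddCommSemigroup R, CommSemigroup R, Neg R, Inv R where
  /-- the distinguished constant (it is not a unit for the multiplication) -/
  eps : R
  add_neg_add : ∀ x : R, x + -x + x = x
  neg_add_neg : ∀ x : R, -x + x + -x = -x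
  mul_inv_mul : ∀ x : R, x * x⁻¹ * x = x
  inv_mul_inv : ∀ x : R, x⁻¹ * x * x⁻¹ = x⁻¹
  idem_iff : ∀ x : R, (x + x = x ∧ x * x = x) ↔ x = eps
  quasidistrib : ∀ x y z : R, CanonLE (x * y + x * z) (x * (y + z))
  mul_canon : ∀ x y z : R, CanonLE y z → CanonLE (x * y) (x * z)
  neg_mul' : ∀ x y : R, -(x * y) = x * -y
  canon_mul : ∀ x y : R, x * x = x → y * y = y → CanonLE ((x + y) + -(x + y)) (x * y + -(x * y))

open CRQSRing

section basic

variable {R : Type*} [CRQSRing R]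

theorem add_quasi_unique {x a b : R} (h1 : x + a + x = x) (h2 : a + x + a = a)
    (h3 : x + b + x = x) (h4 : b + x + b = b) : a = b := by
  have e1 : a = a + x + b := by
    calc a = a + x + a := h2.symm
      _ = a + (x + b + x) + a := by rw [h3]
      _ = (a + x + a) + x + b := by ac_rfl
      _ = a + x + b := by rw [h2]
  have e2 : b = a + x + b := by
    calc b = b + x + b := h4.symm
      _ = b + (x + a + x) + b := by rw [h1]
      _ = a + x + (b + x + b) := by ac_rfl
      _ = a + x + b := by rw [h4]
  exact e1.trans e2.symm

theorem mul_quasi_unique {x a b : R} (h1 : x * a * x = x) (h2 : a * x * a = a)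
    (h3 : x * b * x = x) (h4 : b * x * b = b) : a = b := by
  have e1 : a = a * x * b := by
    calc a = a * x * a := h2.symm
      _ = a * (x * b * x) * a := by rw [h3]
      _ = (a * x * a) * x * b := by ac_rfl
      _ = a * x * b := by rw [h2]
  have e2 : b = a * x * b := by
    calc b = b * x * b := h4.symm
      _ = b * (x * a * x) * b := by rw [h1]
      _ = a * x * (b * x * b) := by ac_rfl
      _ = a * x * b := by rw [h4]
  exact e1.trans e2.symm

theorem neg_eq_of {x a : R} (h1 : x + a + x = x) (h2 : a + x + a = a) : -x = a :=
  add_quasi_unique (add_neg_add x) (neg_add_neg x) h1 h2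

theorem inv_eq_of {x a : R} (h1 : x * a * x = x) (h2 : a * x * a = a) : x⁻¹ = a :=
  mul_quasi_unique (mul_inv_mul x) (inv_mul_inv x) h1 h2

theorem neg_of_idem {x : R} (h : x + x = x) : -x = x := neg_eq_of (by rw [h, h]) (by rw [h, h])

theorem inv_of_idem {x : R} (h : x * x = x) : x⁻¹ = x := inv_eq_of (by rw [h, h]) (by rw [h, h])

theorem nneg (x : R) : - -x = x := neg_eq_of (neg_add_neg x) (add_neg_add x)

theorem iinv (x : R) : (x⁻¹)⁻¹ = x := inv_eq_of (inv_mul_inv x) (mul_inv_mul x)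

theorem neg_add' (x y : R) : -(x + y) = -x + -y := by
  apply neg_eq_of
  · calc x + y + (-x + -y) + (x + y) = (x + -x + x) + (y + -y + y) := by ac_rfl
      _ = x + y := by rw [add_neg_add, add_neg_add]
  · calc -x + -y + (x + y) + (-x + -y) = (-x + x + -x) + (-y + y + -y) := by ac_rfl
      _ = -x + -y := by rw [neg_add_neg, neg_add_neg]

theorem inv_mul' (x y : R) : (x * y)⁻¹ = x⁻¹ * y⁻¹ := by
  apply inv_eq_of
  · calc x * y * (x⁻¹ * y⁻¹) * (x * y) = (x * x⁻¹ * x) * (y * y⁻¹ * y) := by ac_rfl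
      _ = x * y := by rw [mul_inv_mul, mul_inv_mul]
  · calc x⁻¹ * y⁻¹ * (x * y) * (x⁻¹ * y⁻¹) = (x⁻¹ * x * x⁻¹) * (y⁻¹ * y * y⁻¹) := by ac_rfl
      _ = x⁻¹ * y⁻¹ := by rw [inv_mul_inv, inv_mul_inv]

theorem e_idem (x : R) : (x + -x) + (x + -x) = x + -x := by
  rw [← add_assoc, add_neg_add]

theorem e_add (x y : R) : (x + y) + -(x + y) = (x + -x) + (y + -y) := by
  rw [neg_add']; ac_rfl

theorem e_of_idem {x : R} (h : x + x = x) : x + -x = x := by rw [neg_of_idem h, h]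

theorem eb_idem (x : R) : (x * x⁻¹) * (x * x⁻¹) = x * x⁻¹ := by
  rw [← mul_assoc, mul_inv_mul]

theorem self_add_e (x : R) : x + (x + -x) = x := by
  rw [add_comm, add_neg_add]

theorem self_mul_eb (x : R) : x * (x * x⁻¹) = x := by
  rw [mul_comm, mul_inv_mul]

instance instPartialOrder : PartialOrder R where
  le := CanonLE
  le_refl x := (self_add_e x).symm
  le_trans x y z (h1 : x = _) (h2 : y = _) := show x = _ by
    have h3 : x + -x = (y + -y) + (x + -x) := by
      conv_lhs => rw [h1]
      rw [e_add, e_of_idem (e_idem x)]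
    calc x = y + (x + -x) := h1
      _ = z + (y + -y) + (x + -x) := by rw [← h2]
      _ = z + (x + -x) := by rw [add_assoc, ← h3]
  le_antisymm x y (h1 : x = _) (h2 : y = _) := by
    have h3 : x + -x = (y + -y) + (x + -x) := by
      conv_lhs => rw [h1]
      rw [e_add, e_of_idem (e_idem x)]
    have h4 : y + -y = (x + -x) + (y + -y) := by
      conv_lhs => rw [h2]
      rw [e_add, e_of_idem (e_idem y)]
    have h5 : x + -x = y + -y := by rw [h3, add_comm, ← h4]
    rw [h1, h5, self_add_e]

theorem qle_def {x y : R} : x ≤ y ↔ x = y + (x + -x) := Iff.rfl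

theorem qmul_le_mul_left (x : R) {y z : R} (h : y ≤ z) : x * y ≤ x * z := mul_canon x y z h

theorem qmul_le_mul {x x' y y' : R} (h : x ≤ x') (h' : y ≤ y') : x * y ≤ x' * y' := by
  refine (qmul_le_mul_left x h').trans ?_
  rw [mul_comm x, mul_comm x']
  exact qmul_le_mul_left y' h

theorem qadd_le_add {x x' y y' : R} (h : x ≤ x') (h' : y ≤ y') : x + y ≤ x' + y' := by
  rw [qle_def] at *
  rw [e_add]
  calc x + y = (x' + (x + -x)) + (y' + (y + -y)) := by rw [← h, ← h']
    _ = _ := by ac_rfl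

theorem qneg_le_neg {x y : R} (h : x ≤ y) : -x ≤ -y := by
  rw [qle_def] at *
  rw [nneg, add_comm (-x) x]
  conv_lhs => rw [h, neg_add', neg_of_idem (e_idem x)]

theorem add_idem_le (x : R) {f : R} (h : f + f = f) : x + f ≤ x := by
  rw [qle_def, e_add, e_of_idem h, ← add_assoc, self_add_e]

theorem mul_idem {f : R} (x : R) (h : f + f = f) : x * f + x * f = x * f := by
  have h1 := quasidistrib x f f
  rw [h] at h1
  have h2 : x * f + x * f = x * f + ((x * f + x * f) + -(x * f + x * f)) := h1
  rwa [e_add, e_idem, self_add_e] at h2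

theorem eps_add_eps : (eps : R) + eps = eps := ((idem_iff eps).2 rfl).1

theorem eps_mul_eps : (eps : R) * eps = eps := ((idem_iff eps).2 rfl).2

theorem eb_of_idem {f : R} (h : f + f = f) : f * f⁻¹ = eps :=
  (idem_iff _).1 ⟨by rw [mul_comm]; exact mul_idem _ h, eb_idem f⟩

theorem eps_mul_idem {f : R} (h : f + f = f) : eps * f = f := by
  rw [← eb_of_idem h, mul_inv_mul]

theorem inv_idem {f : R} (h : f + f = f) : f⁻¹ + f⁻¹ = f⁻¹ := by
  have e : f⁻¹ * eps = f⁻¹ := by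
    rw [← eb_of_idem h, ← mul_assoc, inv_mul_inv]
  rw [← e]; exact mul_idem _ eps_add_eps

theorem idem_le_iff {f g : R} (hf : f + f = f) : f ≤ g ↔ f = g + f := by
  rw [qle_def, e_of_idem hf]

theorem mul_add_idem (x : R) {f g : R} (hf : f + f = f) (hg : g + g = g) :
    x * (f + g) = x * f + x * g := by
  have hfg : (f + g) + (f + g) = f + g := by rw [add_add_add_comm, hf, hg]
  apply le_antisymm
  · have h1 : x * (f + g) ≤ x * f := qmul_le_mul_left x (add_idem_le f hg)
    have h2 : x * (f + g) ≤ x * g := qmul_le_mul_left x (by rw [add_comm]; exact add_idem_le g hf)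
    have h3 := qadd_le_add h1 h2
    rwa [mul_idem x hfg] at h3
  · exact quasidistrib x f g

end basic

/-! ### The lattice-ordered group of additive idempotents -/

/-- The set of additive idempotents `x + x = x`. -/
def Lam (R : Type*) [CRQSRing R] : Type _ := {x : R // x + x = x}

namespace Lam

variable {R : Type*} [CRQSRing R]

instance : CoeOut (Lam R) R := ⟨Subtype.val⟩

theorem coe_inj {a b : Lam R} (h : (a : R) = b) : a = b := Subtype.ext h

theorem idem (a : Lam R) : (a : R) + a = a := a.2

/-- The group operation is the multiplication of `R`, the neutral element is `eps`. -/
instance : CommGroup (Lam R) where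
  mul a b := ⟨(a : R) * b, mul_idem _ b.2⟩
  one := ⟨eps, eps_add_eps⟩
  inv a := ⟨(a : R)⁻¹, inv_idem a.2⟩
  mul_assoc a b c := coe_inj (mul_assoc (a : R) b c)
  mul_comm a b := coe_inj (mul_comm (a : R) b)
  one_mul a := coe_inj (eps_mul_idem a.2)
  mul_one a := coe_inj ((mul_comm (a : R) eps).trans (eps_mul_idem a.2))
  inv_mul_cancel a := coe_inj ((mul_comm (a : R)⁻¹ a).trans (eb_of_idem a.2))

theorem coe_mul (a b : Lam R) : ((a * b : Lam R) : R) = a * b := rfl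
theorem coe_one : ((1 : Lam R) : R) = eps := rfl
theorem coe_inv (a : Lam R) : ((a⁻¹ : Lam R) : R) = (a : R)⁻¹ := rfl

/-- The order is induced by the canonical order of `R`. -/
instance : PartialOrder (Lam R) where
  le a b := (a : R) ≤ b
  le_refl a := le_refl (a : R)
  le_trans a b c := le_trans (a := (a : R))
  le_antisymm a b h1 h2 := coe_inj (le_antisymm h1 h2)

theorem coe_le {a b : Lam R} : (a : R) ≤ b ↔ a ≤ b := Iff.rfl

instance : IsOrderedMonoid (Lam R) where
  mul_le_mul_left a b h c := show (a : R) * c ≤ b * c from qmul_le_mul h le_rfl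

/-- The meet is the addition of `R`; the join is obtained from it by inversion. -/
instance : Lattice (Lam R) :=
  let add : Lam R → Lam R → Lam R := fun a b =>
    ⟨(a : R) + b, by rw [add_add_add_comm, a.2, b.2]⟩
  have l1 : ∀ a b, add a b ≤ a := fun a b => add_idem_le (a : R) b.2
  have l2 : ∀ a b, add a b ≤ b := fun a b => by
    show (a : R) + b ≤ b
    rw [add_comm]; exact add_idem_le (b : R) a.2
  have l3 : ∀ a b c, a ≤ b → a ≤ c → a ≤ add b c := fun a b c h1 h2 => by
    have h3 := qadd_le_add (coe_le.2 h1) (coe_le.2 h2)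
    rw [a.2] at h3
    exact h3
  { inf := add
    sup := fun a b => (add a⁻¹ b⁻¹)⁻¹
    inf_le_left := l1
    inf_le_right := l2
    le_inf := l3
    le_sup_left := fun a b => by rw [le_inv']; exact l1 _ _
    le_sup_right := fun a b => by rw [le_inv']; exact l2 _ _
    sup_le := fun a b c h1 h2 => by
      rw [inv_le']; exact l3 _ _ _ (inv_le_inv_iff.2 h1) (inv_le_inv_iff.2 h2) }

theorem coe_inf (a b : Lam R) : ((a ⊓ b : Lam R) : R) = a + b := rfl

end Lam

section maps

variable {R : Type*} [CRQSRing R]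

/-- The map `e⁺ : x ↦ x + (-x)`. -/
def ep (x : R) : Lam R := ⟨x + -x, e_idem x⟩

/-- The quasivaluation `v : x ↦ eps * x`. -/
def v (x : R) : Lam R := ⟨eps * x, by rw [mul_comm]; exact mul_idem x eps_add_eps⟩

theorem coe_ep (x : R) : (ep x : R) = x + -x := rfl

theorem coe_v (x : R) : (v x : R) = eps * x := rfl

theorem ep_coe (a : Lam R) : ep (a : R) = a := Lam.coe_inj (e_of_idem a.2)

theorem v_coe (a : Lam R) : v (a : R) = a := Lam.coe_inj (eps_mul_idem a.2)

theorem self_add_ep (x : R) : x + (ep x : R) = x := self_add_e x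

theorem ep_add (x y : R) : ep (x + y) = ep x ⊓ ep y := Lam.coe_inj (e_add x y)

theorem ep_neg (x : R) : ep (-x) = ep x := Lam.coe_inj (by
  rw [coe_ep, coe_ep, nneg, add_comm])

theorem le_iff {x y : R} : x ≤ y ↔ x = y + (ep x : R) := Iff.rfl

theorem ep_mono {x y : R} (h : x ≤ y) : ep x ≤ ep y := by
  rw [le_iff] at h
  rw [h, ep_add]; exact inf_le_left

theorem eq_of_le {x y : R} (h : x ≤ y) (h' : ep y ≤ ep x) : x = y := by
  have e : ep x = ep y := le_antisymm (ep_mono h) h'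
  rw [le_iff] at h
  rw [h, e, self_add_ep]

theorem v_mul (x y : R) : v (x * y) = v x * v y := Lam.coe_inj (by
  rw [Lam.coe_mul, coe_v, coe_v, coe_v, mul_mul_mul_comm, eps_mul_eps])

theorem v_mono {x y : R} (h : x ≤ y) : v x ≤ v y := qmul_le_mul_left eps h

theorem v_add (x y : R) : v x ⊓ v y ≤ v (x + y) := quasidistrib eps x y

theorem v_neg (x : R) : v (-x) = v x := Lam.coe_inj (by
  rw [coe_v, coe_v, ← neg_mul', neg_of_idem]
  exact (v x).2)

theorem v_le_ep (x : R) : v x ≤ ep x := by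
  have h := v_add x (-x)
  rw [v_neg, inf_idem] at h
  rwa [← v_coe (ep x)]

theorem v_eps : v (eps : R) = 1 := Lam.coe_inj eps_mul_eps

theorem ep_eps : ep (eps : R) = 1 := ep_coe (1 : Lam R)

theorem mul_lam (x : R) (a : Lam R) : x * (a : R) = ((v x * a : Lam R) : R) := by
  conv_lhs => rw [← eps_mul_idem a.2]
  rw [Lam.coe_mul, coe_v, ← mul_assoc, mul_comm x]

theorem v_of_mul_idem {x : R} (h : x * x = x) : v x = 1 := by
  have : v x * v x = v x := by rw [← v_mul, h]
  simpa using this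

theorem v_eb (x : R) : v (x * x⁻¹) = 1 := v_of_mul_idem (eb_idem x)

theorem v_inv (x : R) : v x⁻¹ = (v x)⁻¹ := by
  have h := v_eb x
  rw [v_mul] at h
  exact eq_inv_of_mul_eq_one_right h

theorem ep_eq (x : R) : ep x = v x * ep (x * x⁻¹) := by
  apply le_antisymm
  · have h := quasidistrib x (x * x⁻¹) (-(x * x⁻¹))
    rw [← neg_mul', self_mul_eb] at h
    have e := mul_lam x (ep (x * x⁻¹))
    rw [coe_ep] at e
    rw [e] at h
    exact h
  · have h := quasidistrib x⁻¹ x (-x)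
    rw [← neg_mul', mul_comm x⁻¹ x] at h
    have e := mul_lam x⁻¹ (ep x)
    rw [coe_ep] at e
    rw [e] at h
    have h' : ep (x * x⁻¹) ≤ v x⁻¹ * ep x := h
    rw [v_inv] at h'
    calc v x * ep (x * x⁻¹) ≤ v x * ((v x)⁻¹ * ep x) := mul_le_mul_right h' _
      _ = ep x := by simp

theorem ep_mul_eb {x y : R} (hx : x * x = x) (hy : y * y = y) : ep (x * y) = ep x ⊓ ep y := by
  have key : ∀ {x y : R}, x * x = x → ep (x * y) ≤ ep y := by
    intro x y hx
    have h := quasidistrib x y (-y)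
    rw [← neg_mul'] at h
    have e := mul_lam x (ep y)
    rw [coe_ep] at e
    rw [e, v_of_mul_idem hx, one_mul] at h
    exact h
  apply le_antisymm
  · refine le_inf ?_ (key hx)
    rw [mul_comm]; exact key hy
  · rw [← ep_add]; exact canon_mul x y hx hy

theorem ep_mul (x y : R) : ep (x * y) = (v x * ep y) ⊓ (v y * ep x) := by
  have e : x * y * (x * y)⁻¹ = (x * x⁻¹) * (y * y⁻¹) := by rw [inv_mul']; ac_rfl
  rw [ep_eq (x * y), e, ep_mul_eb (eb_idem x) (eb_idem y), v_mul, mul_inf, ep_eq y, ep_eq x,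
    inf_comm]
  congr 1
  · rw [mul_assoc]
  · rw [mul_assoc, mul_left_comm]

theorem add_lam_eq {x y : R} {a : Lam R} (h : x ≤ y) (ha : a ≤ ep x) :
    x + (a : R) = y + (a : R) := by
  refine eq_of_le (qadd_le_add h le_rfl) ?_
  rw [ep_add, ep_add, ep_coe]
  exact le_inf (inf_le_right.trans ha) inf_le_right

theorem add_lam_le (x : R) (a : Lam R) : x + (a : R) ≤ x := add_idem_le x a.2

theorem v_add_lam (x : R) (a : Lam R) : v (x + (a : R)) = v x ⊓ a := by
  apply le_antisymm
  · refine le_inf (v_mono (add_lam_le x a)) ((v_le_ep _).trans ?_)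
    rw [ep_add, ep_coe]; exact inf_le_right
  · have := v_add x (a : R)
    rwa [v_coe] at this

theorem le_add_v_sub {x y u : R} (h1 : u ≤ x) (h2 : u ≤ y) : u ≤ x + (v (x + -y) : R) := by
  have h3 : (ep u : R) ≤ x + -y := qadd_le_add h1 (qneg_le_neg h2)
  have h4 := v_mono h3
  rw [v_coe] at h4
  rw [← self_add_ep u]
  exact qadd_le_add h1 h4

end maps

/-! ### Directed and superrigid quasi-semirings -/

/-- `R` is directed if `eps ≤ x` for all multiplicative idempotents `x`. -/
class IsDirectedQS (R : Type*) [CRQSRing R] : Prop where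
  eps_le : ∀ x : R, x * x = x → eps ≤ x

/-- `R` is superrigid if it is directed and `e⁺`, restricted to the multiplicative idempotents, is
surjective onto the nonnegative elements of `Lam R`. -/
class IsSuperrigid (R : Type*) [CRQSRing R] : Prop extends IsDirectedQS R where
  exists_idem : ∀ α : Pos (Lam R), ∃ x : R, x * x = x ∧ ep x = (α : Lam R)

section directed

variable {R : Type*} [CRQSRing R] [IsDirectedQS R]

theorem v_le (x : R) : (v x : R) ≤ x := by
  have h := qmul_le_mul_left x (IsDirectedQS.eps_le (x * x⁻¹) (eb_idem x))
  rw [self_mul_eb, mul_comm] at h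
  exact h

theorem add_v_sub (x y : R) : x + (v (x + -y) : R) = y + (v (x + -y) : R) := by
  have h : (v (x + -y) : R) ≤ x + -y := v_le _
  have hle : v (x + -y) ≤ ep x := by
    refine (v_le_ep _).trans ?_
    rw [ep_add]; exact inf_le_left
  rw [le_iff, ep_coe] at h
  have e1 : y + (v (x + -y) : R) = x + (ep y : R) + (v (x + -y) : R) := by
    conv_lhs => rw [h]
    rw [coe_ep]; ac_rfl
  rw [e1, add_assoc, ← Lam.coe_inf, inf_eq_right.2]
  refine (v_le_ep _).trans ?_
  rw [ep_add, ep_neg]; exact inf_le_right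

/-- In the directed case every pair has a meet, namely `x + v (x - y)`. -/
instance instSemilatticeInf : SemilatticeInf R where
  inf x y := x + (v (x + -y) : R)
  inf_le_left x y := add_lam_le _ _
  inf_le_right x y := by
    show x + (v (x + -y) : R) ≤ y
    rw [add_v_sub]; exact add_lam_le _ _
  le_inf u x y h1 h2 := le_add_v_sub h1 h2

theorem inf_def (x y : R) : x ⊓ y = x + (v (x + -y) : R) := rfl

theorem qmul_inf (x y z : R) : x * (y ⊓ z) = (x * y) ⊓ (x * z) := by
  apply le_antisymm
  · exact le_inf (qmul_le_mul_left x inf_le_left) (qmul_le_mul_left x inf_le_right)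
  · have h1 : x * y + -(x * z) ≤ x * (y + -z) := by
      rw [neg_mul']; exact quasidistrib x y (-z)
    have h2 : (v (x * y + -(x * z)) : R) ≤ x * (v (y + -z) : R) := by
      rw [mul_lam, ← v_mul]
      exact v_mono h1
    exact (qadd_le_add le_rfl h2).trans (quasidistrib x y _)

theorem idem_le_of_ep_le {x y : R} (hx : x * x = x) (hy : y * y = y) (h : ep x ≤ ep y) :
    x ≤ y := by
  obtain ⟨m, hm⟩ : ∃ m, m = x ⊓ y := ⟨_, rfl⟩
  have mx : m ≤ x := hm ▸ inf_le_left
  have my : m ≤ y := hm ▸ inf_le_right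
  have em : eps ≤ m := by
    rw [hm]; exact le_inf (IsDirectedQS.eps_le x hx) (IsDirectedQS.eps_le y hy)
  have vm : v m = 1 := by
    apply le_antisymm
    · have := v_mono mx
      rwa [v_of_mul_idem hx] at this
    · have := v_mono em
      rwa [v_eps] at this
  have mm : m * m ≤ x * y := qmul_le_mul mx my
  have mm' : m * m = m := by
    have h1 : m * m ≤ m := by
      rw [hm]
      refine le_inf ?_ ?_
      · have := qmul_le_mul (inf_le_left : x ⊓ y ≤ x) (inf_le_left : x ⊓ y ≤ x)
        rwa [hx] at this
      · have := qmul_le_mul (inf_le_right : x ⊓ y ≤ y) (inf_le_right : x ⊓ y ≤ y)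
        rwa [hy] at this
    refine eq_of_le h1 ?_
    rw [ep_mul, vm, one_mul, inf_idem]
  have e1 : x * y * m = x * y := by
    rw [hm, qmul_inf, mul_assoc x y y, hy, mul_comm x y, mul_assoc y x x, hx, inf_idem]
  have hxy : (x * y) * (x * y) = x * y := by rw [mul_mul_mul_comm, hx, hy]
  have e2 : ep (x * y) ≤ ep m := by
    rw [← e1, ep_mul_eb hxy mm']; exact inf_le_right
  rw [mm'] at mm
  have e3 : m = x := by
    refine eq_of_le mx ?_
    have : ep (x * y) = ep x := by rw [ep_mul_eb hx hy, inf_eq_left.2 h]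
    rwa [this] at e2
  exact e3 ▸ my

theorem idem_mul_le {x : R} (y : R) (hx : x * x = x) : x * y ≤ y := by
  have h : x * (y * y⁻¹) ≤ y * y⁻¹ := by
    refine idem_le_of_ep_le ?_ (eb_idem y) ?_
    · rw [mul_mul_mul_comm, hx, eb_idem]
    · rw [ep_mul_eb hx (eb_idem y)]; exact inf_le_right
  have h2 := qmul_le_mul_left y h
  rw [self_mul_eb, mul_left_comm, self_mul_eb] at h2
  exact h2

end directed

/-! ### The ring associated to a directed quasi-semiring -/

/-- The inverse limit of the groups `R_α = {x : e⁺ x = α}`, `α ∈ Λ₊`, with respect to the maps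
`x ↦ x + α`: the monotone sections `φ : Λ₊ → R` of `e⁺`. -/
structure LimRing (R : Type*) [CRQSRing R] where
  /-- the underlying map -/
  toFun : Pos (Lam R) → R
  ep_toFun : ∀ α, ep (toFun α) = (α : Lam R)
  mono' : ∀ α β, α ≤ β → toFun α ≤ toFun β

namespace LimRing

section add

variable {R : Type*} [CRQSRing R]

instance : CoeFun (LimRing R) (fun _ => Pos (Lam R) → R) := ⟨LimRing.toFun⟩

theorem ext {φ ψ : LimRing R} (h : ∀ α, φ α = ψ α) : φ = ψ := by
  cases φ; cases ψ; congr; exact funext h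

theorem ep_apply (φ : LimRing R) (α : Pos (Lam R)) : ep (φ α) = (α : Lam R) := φ.ep_toFun α

theorem mono (φ : LimRing R) {α β : Pos (Lam R)} (h : α ≤ β) : φ α ≤ φ β := φ.mono' α β h

theorem one_le (α : Pos (Lam R)) : (1 : Pos (Lam R)) ≤ α := α.2

theorem eq_add (φ : LimRing R) {α β : Pos (Lam R)} (h : α ≤ β) :
    φ α = φ β + ((α : Lam R) : R) := by
  have := φ.mono h
  rwa [le_iff, ep_apply] at this

/-- Pointwise addition. -/
instance : Add (LimRing R) where
  add φ ψ := ⟨fun α => φ α + ψ α, fun α => by rw [ep_add, ep_apply, ep_apply, inf_idem],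
    fun α β h => qadd_le_add (φ.mono h) (ψ.mono h)⟩

/-- The neutral element is the inclusion `Λ₊ → R`. -/
instance : Zero (LimRing R) where
  zero := ⟨fun α => ((α : Lam R) : R), fun α => ep_coe _, fun α β h => h⟩

/-- Pointwise negation. -/
instance : Neg (LimRing R) where
  neg φ := ⟨fun α => -φ α, fun α => by rw [ep_neg, ep_apply],
    fun α β h => qneg_le_neg (φ.mono h)⟩

instance : AddCommGroup (LimRing R) where
  add_assoc φ ψ χ := ext fun α => add_assoc (φ α) (ψ α) (χ α)
  add_comm φ ψ := ext fun α => add_comm (φ α) (ψ α)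
  zero_add φ := ext fun α => show ((α : Lam R) : R) + φ α = φ α by
    rw [add_comm]
    have := self_add_ep (φ α)
    rwa [ep_apply] at this
  add_zero φ := ext fun α => show φ α + ((α : Lam R) : R) = φ α by
    have := self_add_ep (φ α)
    rwa [ep_apply] at this
  neg_add_cancel φ := ext fun α => show -φ α + φ α = ((α : Lam R) : R) by
    rw [add_comm, ← coe_ep, ep_apply]
  nsmul := nsmulRec
  zsmul := zsmulRec

theorem add_apply (φ ψ : LimRing R) (α : Pos (Lam R)) : (φ + ψ) α = φ α + ψ α := rfl

theorem neg_apply (φ : LimRing R) (α : Pos (Lam R)) : (-φ) α = -φ α := rfl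

theorem zero_apply (α : Pos (Lam R)) : (0 : LimRing R) α = ((α : Lam R) : R) := rfl

/-- The element `v(φ(ε))⁻¹` of `Λ₊`. -/
def minus (φ : LimRing R) : Pos (Lam R) :=
  ⟨(v (φ 1))⁻¹, by
    have h := v_le_ep (φ 1)
    rw [ep_apply] at h
    exact one_le_inv'.2 h⟩

theorem coe_minus (φ : LimRing R) : (φ.minus : Lam R) = (v (φ 1))⁻¹ := rfl

theorem le_v_mul (φ : LimRing R) (α γ δ : Pos (Lam R)) (h : α * φ.minus ≤ γ) :
    (α : Lam R) ≤ v (φ δ) * γ := by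
  have h' : (α : Lam R) * (v (φ 1))⁻¹ ≤ γ := h
  calc (α : Lam R) = v (φ 1) * (α * (v (φ 1))⁻¹) := by rw [mul_left_comm]; simp
    _ ≤ v (φ δ) * γ := mul_le_mul' (v_mono (φ.mono (one_le δ))) h'

theorem le_ep_mul (φ ψ : LimRing R) (α γ δ : Pos (Lam R)) (h₁ : α * ψ.minus ≤ γ)
    (h₂ : α * φ.minus ≤ δ) : (α : Lam R) ≤ ep (φ γ * ψ δ) := by
  rw [ep_mul, ep_apply, ep_apply]
  exact le_inf (le_v_mul φ α δ γ h₂) (le_v_mul ψ α γ δ h₁)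

theorem mul_aux (φ ψ : LimRing R) (α γ δ : Pos (Lam R)) (h₁ : α * ψ.minus ≤ γ)
    (h₂ : α * φ.minus ≤ δ) :
    φ (α * ψ.minus) * ψ (α * φ.minus) + ((α : Lam R) : R) = φ γ * ψ δ + ((α : Lam R) : R) :=
  add_lam_eq (qmul_le_mul (φ.mono h₁) (ψ.mono h₂)) (le_ep_mul φ ψ α _ _ le_rfl le_rfl)

/-- The product `(φ ψ)(α) = φ(α v(ψ(ε))⁻¹) ψ(α v(φ(ε))⁻¹) + α`. -/
instance : Mul (LimRing R) where
  mul φ ψ := ⟨fun α => φ (α * ψ.minus) * ψ (α * φ.minus) + ((α : Lam R) : R),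
    fun α => by
      rw [ep_add, ep_coe, inf_eq_right]
      exact le_ep_mul φ ψ α _ _ le_rfl le_rfl,
    fun α β h => qadd_le_add (qmul_le_mul (φ.mono (mul_le_mul_left h _))
      (ψ.mono (mul_le_mul_left h _))) h⟩

theorem mul_apply (φ ψ : LimRing R) (α γ δ : Pos (Lam R)) (h₁ : α * ψ.minus ≤ γ)
    (h₂ : α * φ.minus ≤ δ) : (φ * ψ) α = φ γ * ψ δ + ((α : Lam R) : R) :=
  mul_aux φ ψ α γ δ h₁ h₂

theorem mul_apply_large (φ ψ : LimRing R) (α : Pos (Lam R)) :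
    ∃ γ₀ : Pos (Lam R), ∀ γ, γ₀ ≤ γ →
      (φ * ψ) α = φ γ * ψ γ + ((α : Lam R) : R) ∧ (α : Lam R) ≤ ep (φ γ * ψ γ) := by
  refine ⟨α * ψ.minus * φ.minus, fun γ h => ?_⟩
  have h₁ : α * ψ.minus ≤ γ := (le_mul_of_one_le_right' (one_le _)).trans h
  have h₂ : α * φ.minus ≤ γ := by
    rw [mul_right_comm] at h
    exact (le_mul_of_one_le_right' (one_le _)).trans h
  exact ⟨mul_apply φ ψ α γ γ h₁ h₂, le_ep_mul φ ψ α γ γ h₁ h₂⟩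

protected theorem mul_comm (φ ψ : LimRing R) : φ * ψ = ψ * φ := ext fun α => by
  obtain ⟨γ₁, h₁⟩ := mul_apply_large φ ψ α
  obtain ⟨γ₂, h₂⟩ := mul_apply_large ψ φ α
  rw [(h₁ (γ₁ * γ₂) (le_mul_of_one_le_right' (one_le _))).1,
    (h₂ (γ₁ * γ₂) (le_mul_of_one_le_left' (one_le _))).1, mul_comm (φ _)]

theorem mul_mul_apply_large (φ ψ χ : LimRing R) (α : Pos (Lam R)) :
    ∃ γ₀ : Pos (Lam R), ∀ γ, γ₀ ≤ γ →
      (φ * ψ * χ) α = φ γ * ψ γ * χ γ + ((α : Lam R) : R) := by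
  obtain ⟨η, hη⟩ := mul_apply_large (φ * ψ) χ α
  obtain ⟨δ, hδ⟩ := mul_apply_large φ ψ η
  refine ⟨η * δ, fun γ hγ => ?_⟩
  have hηγ : η ≤ γ := (le_mul_of_one_le_right' (one_le _)).trans hγ
  have hδγ : δ ≤ γ := (le_mul_of_one_le_left' (one_le _)).trans hγ
  obtain ⟨e, he⟩ := hη η le_rfl
  rw [e]
  refine add_lam_eq (qmul_le_mul ?_ (χ.mono hηγ)) he
  rw [(hδ γ hδγ).1]
  exact add_lam_le _ _

protected theorem mul_assoc (φ ψ χ : LimRing R) : φ * ψ * χ = φ * (ψ * χ) := ext fun α => by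
  obtain ⟨γ₁, h₁⟩ := mul_mul_apply_large φ ψ χ α
  obtain ⟨γ₂, h₂⟩ := mul_mul_apply_large ψ χ φ α
  rw [LimRing.mul_comm φ (ψ * χ), h₁ (γ₁ * γ₂) (le_mul_of_one_le_right' (one_le _)),
    h₂ (γ₁ * γ₂) (le_mul_of_one_le_left' (one_le _)), mul_assoc (φ _), mul_comm (φ _)]

protected theorem mul_add (φ ψ χ : LimRing R) : φ * (ψ + χ) = φ * ψ + φ * χ := ext fun α => by
  obtain ⟨γ₁, h₁⟩ := mul_apply_large φ ψ α
  obtain ⟨γ₂, h₂⟩ := mul_apply_large φ χ α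
  obtain ⟨γ₃, h₃⟩ := mul_apply_large φ (ψ + χ) α
  obtain ⟨e₁, f₁⟩ := h₁ (γ₁ * γ₂ * γ₃)
    ((le_mul_of_one_le_right' (one_le _)).trans (le_mul_of_one_le_right' (one_le _)))
  obtain ⟨e₂, f₂⟩ := h₂ (γ₁ * γ₂ * γ₃)
    ((le_mul_of_one_le_left' (one_le _)).trans (le_mul_of_one_le_right' (one_le _)))
  obtain ⟨e₃, f₃⟩ := h₃ (γ₁ * γ₂ * γ₃) (le_mul_of_one_le_left' (one_le _))
  rw [add_apply, e₁, e₂, e₃, add_add_add_comm, Lam.idem]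
  symm
  refine add_lam_eq (quasidistrib _ _ _) ?_
  rw [ep_add]
  exact le_inf f₁ f₂

/-- The associated map `w : B → Λ̂`, `w φ = v ∘ φ`. -/
def w (φ : LimRing R) : LHat (Lam R) :=
  ⟨fun α => v (φ α), fun α β h => by rw [φ.eq_add h, v_add_lam]⟩

theorem w_apply (φ : LimRing R) (α : Pos (Lam R)) : w φ α = v (φ α) := rfl

theorem w_add (φ ψ : LimRing R) : w φ ⊓ w ψ ≤ w (φ + ψ) := fun _ => v_add _ _

theorem w_zero : w (0 : LimRing R) = ⊤ := LHat.ext fun α => v_coe (α : Lam R)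

theorem w_neg (φ : LimRing R) : w (-φ) = w φ := LHat.ext fun _ => v_neg _

end add

section one

variable {R : Type*} [CRQSRing R] [IsSuperrigid R]

/-- The unique multiplicative idempotent `x` with `e⁺ x = α`. -/
noncomputable def unitAt (α : Pos (Lam R)) : R := (IsSuperrigid.exists_idem α).choose

theorem unitAt_mul_self (α : Pos (Lam R)) : unitAt α * unitAt α = unitAt α :=
  (IsSuperrigid.exists_idem α).choose_spec.1

theorem ep_unitAt (α : Pos (Lam R)) : ep (unitAt α) = (α : Lam R) :=
  (IsSuperrigid.exists_idem α).choose_spec.2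

/-- The ring structure; the unit sends `α` to the idempotent `unitAt α`. -/
noncomputable instance : CommRing (LimRing R) where
  __ := (inferInstance : AddCommGroup (LimRing R))
  mul_comm := LimRing.mul_comm
  mul_assoc := LimRing.mul_assoc
  left_distrib := LimRing.mul_add
  right_distrib φ ψ χ := by
    rw [LimRing.mul_comm, LimRing.mul_add, LimRing.mul_comm χ, LimRing.mul_comm χ]
  zero_mul φ := by
    have h := LimRing.mul_add φ 0 0
    rw [add_zero] at h
    rw [LimRing.mul_comm]
    exact left_eq_add.1 h
  mul_zero φ := by
    have h := LimRing.mul_add φ 0 0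
    rw [add_zero] at h
    exact left_eq_add.1 h
  one := ⟨unitAt, ep_unitAt, fun α β h => idem_le_of_ep_le (unitAt_mul_self α)
    (unitAt_mul_self β) (by rw [ep_unitAt, ep_unitAt]; exact h)⟩
  one_mul φ := ext fun α => by
    obtain ⟨γ, h⟩ := mul_apply_large ⟨unitAt, ep_unitAt, fun α β h => idem_le_of_ep_le
      (unitAt_mul_self α) (unitAt_mul_self β) (by rw [ep_unitAt, ep_unitAt]; exact h)⟩ φ α
    obtain ⟨e, f⟩ := h (γ * α) (le_mul_of_one_le_right' (one_le _))
    refine e.trans ?_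
    rw [φ.eq_add (show α ≤ γ * α from le_mul_of_one_le_left' (one_le _))]
    exact add_lam_eq (idem_mul_le _ (unitAt_mul_self _)) f
  mul_one φ := by
    rw [LimRing.mul_comm]
    exact ext fun α => by
      obtain ⟨γ, h⟩ := mul_apply_large ⟨unitAt, ep_unitAt, fun α β h => idem_le_of_ep_le
        (unitAt_mul_self α) (unitAt_mul_self β) (by rw [ep_unitAt, ep_unitAt]; exact h)⟩ φ α
      obtain ⟨e, f⟩ := h (γ * α) (le_mul_of_one_le_right' (one_le _))
      refine e.trans ?_
      rw [φ.eq_add (show α ≤ γ * α from le_mul_of_one_le_left' (one_le _))]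
      exact add_lam_eq (idem_mul_le _ (unitAt_mul_self _)) f

theorem one_apply (α : Pos (Lam R)) : (1 : LimRing R) α = unitAt α := rfl

theorem w_mul (φ ψ : LimRing R) : w (φ * ψ) = w φ * w ψ := LHat.ext fun α => by
  obtain ⟨γ₁, h₁⟩ := mul_apply_large φ ψ α
  obtain ⟨γ₂, -, h₂⟩ := LHat.mul_apply' (w φ) (w ψ) α
  rw [w_apply, (h₁ (γ₁ * γ₂) (le_mul_of_one_le_right' (one_le _))).1, v_add_lam,
    h₂ (γ₁ * γ₂) (le_mul_of_one_le_left' (one_le _)), v_mul]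
  rfl

theorem w_one : w (1 : LimRing R) = 1 := LHat.ext fun α => by
  rw [w_apply, one_apply, v_of_mul_idem (unitAt_mul_self α)]
  exact (inf_eq_left.2 α.2).symm

theorem LHat_mul_mono {Λ : Type*} [CommGroup Λ] [Lattice Λ] [IsOrderedMonoid Λ]
    {a b c : LHat Λ} (h : a ≤ b) : a * c ≤ b * c := fun α => by
  obtain ⟨γ₁, -, h₁⟩ := LHat.mul_apply' a c α
  obtain ⟨γ₂, -, h₂⟩ := LHat.mul_apply' b c α
  rw [h₁ (γ₁ * γ₂) (le_mul_of_one_le_right' (LHat.one_le _)),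
    h₂ (γ₁ * γ₂) (le_mul_of_one_le_left' (LHat.one_le _))]
  exact inf_le_inf_right _ (mul_le_mul_left (h _) _)

/-- The subring `A = {φ : 1 ≤ w φ}` of `B`. -/
def valuationSubring (R : Type*) [CRQSRing R] [IsSuperrigid R] : Subring (LimRing R) where
  carrier := {φ | 1 ≤ w φ}
  mul_mem' {φ ψ} (h₁ : 1 ≤ w φ) (h₂ : 1 ≤ w ψ) := show 1 ≤ w (φ * ψ) by
    rw [w_mul]
    refine h₂.trans ?_
    have := LHat_mul_mono (c := w ψ) h₁
    rwa [one_mul] at this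
  one_mem' := show 1 ≤ w (1 : LimRing R) by rw [w_one]
  add_mem' {φ ψ} (h₁ : 1 ≤ w φ) (h₂ : 1 ≤ w ψ) := (le_inf h₁ h₂).trans (w_add φ ψ)
  zero_mem' := show 1 ≤ w (0 : LimRing R) by rw [w_zero]; exact le_top
  neg_mem' {φ} (h : 1 ≤ w φ) := show 1 ≤ w (-φ) by rwa [w_neg]

end one

end LimRing

/-! ### Finitely generated submodules and Prüfer extensions -/

/-- The monoid `M(A, B)` of the finitely generated `A`-submodules of `B`. -/
def FGMod {B : Type*} [CommRing B] (A : Subring B) : Submonoid (Submodule A B) where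
  carrier := {I | I.FG}
  mul_mem' h₁ h₂ := h₁.mul h₂
  one_mem' := by
    show (1 : Submodule A B).FG
    rw [Submodule.one_eq_span]
    exact Submodule.fg_span_singleton _

/-- `A ⊆ B` is a Prüfer extension if every finitely generated `A`-submodule `I` of `B` which is
`B`-regular (i.e. `I B = B`) is invertible. -/
def IsPruferExt {B : Type*} [CommRing B] (A : Subring B) : Prop :=
  ∀ I : FGMod A, (I : Submodule A B) * ⊤ = ⊤ → IsUnit I

section value

variable {R : Type*} [CRQSRing R] [IsSuperrigid R]

open LimRing

theorem inf_w_le (s : Finset (LimRing R)) {φ : LimRing R}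
    (h : φ ∈ Submodule.span (valuationSubring R) (s : Set (LimRing R))) : s.inf w ≤ w φ := by
  induction h using Submodule.span_induction with
  | mem x hx => exact Finset.inf_le hx
  | zero => rw [w_zero]; exact le_top
  | add x y _ _ hx hy => exact (le_inf hx hy).trans (w_add x y)
  | smul a x _ hx =>
    have ha : 1 ≤ w (a : LimRing R) := a.2
    have h := LHat_mul_mono (c := w x) ha
    rw [one_mul, ← w_mul] at h
    exact hx.trans h

/-- The map `ŵ : M(A, B) → Λ̂` sending a finitely generated submodule to the meet of the values of
a system of generators. It does not depend on the choice of the system of generators, see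
`wHat_eq`. -/
noncomputable def wHat (I : FGMod (valuationSubring R)) : LHat (Lam R) :=
  (Classical.choose I.2 : Finset (LimRing R)).inf w

theorem wHat_eq (I : FGMod (valuationSubring R)) (s : Finset (LimRing R))
    (h : Submodule.span (valuationSubring R) (s : Set (LimRing R)) = I) :
    wHat I = s.inf w := by
  have h' : Submodule.span (valuationSubring R)
      ((Classical.choose I.2 : Finset (LimRing R)) : Set (LimRing R)) = I :=
    Classical.choose_spec I.2
  apply le_antisymm
  · refine Finset.le_inf fun x hx => inf_w_le _ ?_
    rw [h', ← h]; exact Submodule.subset_span hx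
  · refine Finset.le_inf fun x hx => inf_w_le _ ?_
    rw [h, ← h']; exact Submodule.subset_span hx

end value

/-- The group of those elements of the submonoid `ŵ(M)` of `Λ̂` that are invertible in it. -/
def valueUnits (R : Type*) [CRQSRing R] [IsSuperrigid R] : Set (LHat (Lam R)) :=
  {θ | θ ∈ Set.range (wHat (R := R)) ∧ ∃ ψ ∈ Set.range (wHat (R := R)), θ * ψ = 1}

/-- `R` is Prüfer if `A ⊆ B` is a Prüfer extension. -/
def IsPruferQS (R : Type*) [CRQSRing R] [IsSuperrigid R] : Prop :=
  IsPruferExt (LimRing.valuationSubring R)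

/-- `R` is Prüfer–Manis in the strong sense: it is Prüfer, the invertible elements of `ŵ(M)` are
exactly the elements of `Λ`, and `ŵ` induces an isomorphism of ordered groups from the group `M*`
of invertible finitely generated submodules (ordered by reverse inclusion) onto `Λ`. -/
def IsStronglyPruferManis (R : Type*) [CRQSRing R] [IsSuperrigid R] : Prop :=
  IsPruferQS R ∧
  valueUnits R = Set.range (LHat.embed : Lam R → LHat (Lam R)) ∧
  ∃ f : (FGMod (LimRing.valuationSubring R))ˣ ≃* Lam R,
    (∀ I : (FGMod (LimRing.valuationSubring R))ˣ,
      wHat (I : FGMod (LimRing.valuationSubring R)) = LHat.embed (f I)) ∧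
    ∀ I J : (FGMod (LimRing.valuationSubring R))ˣ, f I ≤ f J ↔
      ((J : FGMod (LimRing.valuationSubring R)) :
        Submodule (LimRing.valuationSubring R) (LimRing R)) ≤
      (I : FGMod (LimRing.valuationSubring R))

/-! ### Completeness and the metric structure -/

/-- `R` is (spherically) complete if through every element `x` there passes a monotone section of
`e⁺` defined on all of `Λ`. -/
def IsCompleteQS (R : Type*) [CRQSRing R] : Prop :=
  ∀ x : R, ∃ φ : Lam R → R, (∀ α, ep (φ α) = α) ∧ (∀ α β, α ≤ β → φ α ≤ φ β) ∧ φ (ep x) = x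

section metric

variable {R : Type*} [CRQSRing R] [IsDirectedQS R]

/-- The `Λ`-valued distance `d(x, y) = e⁺(x) e⁺(y) / e⁺(x ∧ y)²`. -/
def qdist (x y : R) : Lam R := ep x * ep y / ep (x ⊓ y) ^ 2

/-- The cell `[x, y]` of all `z ≥ x ∧ y` such that `z` is the join of `x ∧ z` and `y ∧ z`. -/
def cell (x y : R) : Set R := {z | x ⊓ y ≤ z ∧ IsLUB {x ⊓ z, y ⊓ z} z}

end metric

/-- `R` is locally faithfully full if all maps `d(x, -) : [x, y] → [1, d(x, y)]` are bijective. -/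
def IsLFF (R : Type*) [CRQSRing R] [IsDirectedQS R] : Prop :=
  ∀ x y : R, Set.BijOn (qdist x) (cell x y) (Set.Icc 1 (qdist x y))

/-- `R` is median if `[x, y] ∩ [y, z] ∩ [z, x]` consists of a single element for all `x, y, z`. -/
def IsMedianQS (R : Type*) [CRQSRing R] [IsDirectedQS R] : Prop :=
  ∀ x y z : R, ∃! u, u ∈ cell x y ∩ cell y z ∩ cell z x

end CRQ

/-! Everything rests on the modules `valIdeal γ` of elements of `B` of value at least `γ`.
Completeness makes division possible up to any precision: if `w φ ⊓ δ ≤ w ψ`, truncate both sections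
at `δ`, form the quotient `x⁻¹ * y` in `R`, and lift it to `B`. So `ψ` is an `A`-multiple of `φ`
modulo `valIdeal δ` (`exists_quotient`), and a finitely generated module plus `valIdeal δ` is always
some `valIdeal η` (`exists_span_sup`).

An invertible module of value `γ` equals `valIdeal γ` (`coe_unit_eq_valIdeal`), so by the
surjectivity hypothesis every `valIdeal γ` is finitely generated and invertible. If `I B = B`, then
`I` contains some `valIdeal b`; hence `I = I + valIdeal b` is some `valIdeal η`, which is
invertible. This is the Prüfer property. The value map is multiplicative on modules and determines
an invertible module, which gives the ordered isomorphism onto `Λ`.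

Finite generation also gives `valIdeal γ + valIdeal δ = valIdeal (γ ⊓ δ)` (`valIdeal_sup`), a form
of the Chinese remainder theorem. Lift `x` and `y` to sections `φ` and `ψ`. If `x` and `y` agree as
far as `ep x ⊓ ep y`, then `φ - ψ = a + b` with `a` and `b` of value at least `ep x` and `ep y`, and
the section `φ - a = ψ + b` passes through both elements. So compatible pairs have joins
(`HasJoins`).

With joins the metric claims become computations in the distributive lattice `Λ`. A point `z` of a
cell amounts to the pair `ep (x ⊓ z)`, `ep (y ⊓ z)`, whose meet is `ep (x ⊓ y)`, and `qdist x z`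
determines this pair. The median is the join of the three pairwise meets. -/

namespace CRQ

/-! ### The embedding of `Λ` in `Λ̂`, and the bounded elements of `Λ̂`. -/

namespace LHat

variable {Λ : Type*} [CommGroup Λ] [Lattice Λ] [IsOrderedMonoid Λ]

theorem exists_pos_ge (a : Λ) : ∃ α : Pos Λ, a ≤ (α : Λ) := ⟨⟨a ⊔ 1, le_sup_right⟩, le_sup_left⟩

theorem embed_apply (γ : Λ) (α : Pos Λ) : embed γ α = γ ⊓ (α : Λ) := rfl

theorem embed_le_embed {γ δ : Λ} : embed γ ≤ embed δ ↔ γ ≤ δ := by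
  constructor
  · intro h
    obtain ⟨α, hα⟩ := exists_pos_ge γ
    have := h α
    rw [embed_apply, embed_apply, inf_eq_left.2 hα] at this
    exact this.trans inf_le_left
  · exact fun h α => inf_le_inf_right _ h

theorem embed_injective : Function.Injective (embed : Λ → LHat Λ) := fun _ _ h =>
  le_antisymm (embed_le_embed.1 h.le) (embed_le_embed.1 h.ge)

theorem embed_one : (embed 1 : LHat Λ) = 1 := rfl

theorem embed_mul (γ δ : Λ) : embed (γ * δ) = embed γ * embed δ := by
  apply ext; intro α
  obtain ⟨η, -, h⟩ := mul_apply' (embed γ) (embed δ) α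
  obtain ⟨β₁, h₁⟩ := exists_pos_ge γ
  obtain ⟨β₂, h₂⟩ := exists_pos_ge δ
  have k₁ : γ ≤ (η * β₁ * β₂ : Pos Λ) := h₁.trans
    ((le_mul_of_one_le_left' (one_le η)).trans
      (le_mul_of_one_le_right' (one_le β₂) : η * β₁ ≤ η * β₁ * β₂))
  have k₂ : δ ≤ (η * β₁ * β₂ : Pos Λ) := h₂.trans
    (le_mul_of_one_le_left' (one_le (η * β₁)) : β₂ ≤ η * β₁ * β₂)
  rw [h (η * β₁ * β₂) (by rw [mul_assoc]; exact le_mul_of_one_le_right' (one_le _)),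
    embed_apply, embed_apply, embed_apply, inf_eq_left.2 k₁, inf_eq_left.2 k₂]

theorem mul_le_mul_left_of_le {a b : LHat Λ} (c : LHat Λ) (h : a ≤ b) : c * a ≤ c * b := by
  rw [mul_comm c, mul_comm c]; exact LimRing.LHat_mul_mono h

theorem mul_le_mul {a b c d : LHat Λ} (h : a ≤ b) (h' : c ≤ d) : a * c ≤ b * d :=
  (LimRing.LHat_mul_mono h).trans (mul_le_mul_left_of_le b h')

theorem inf_mul (a b c : LHat Λ) : (a ⊓ b) * c = a * c ⊓ b * c := by
  apply ext; intro α
  obtain ⟨γ₁, -, h₁⟩ := mul_apply' a c α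
  obtain ⟨γ₂, -, h₂⟩ := mul_apply' b c α
  obtain ⟨γ₃, -, h₃⟩ := mul_apply' (a ⊓ b) c α
  have l₁ : γ₁ ≤ γ₁ * γ₂ * γ₃ :=
    (le_mul_of_one_le_right' (one_le _)).trans (le_mul_of_one_le_right' (one_le _))
  have l₂ : γ₂ ≤ γ₁ * γ₂ * γ₃ :=
    (le_mul_of_one_le_left' (one_le _)).trans (le_mul_of_one_le_right' (one_le _))
  have l₃ : γ₃ ≤ γ₁ * γ₂ * γ₃ := le_mul_of_one_le_left' (one_le _)
  rw [inf_apply, h₁ _ l₁, h₂ _ l₂, h₃ _ l₃, inf_apply, _root_.inf_mul, inf_inf_distrib_right]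

theorem top_mul (c : LHat Λ) : ⊤ * c = ⊤ := by
  apply le_antisymm le_top
  intro α
  rw [mul_apply ⊤ c α (α * c.minus * (⊤ : LHat Λ).minus)
    (le_mul_of_one_le_right' (one_le _))
    (by rw [mul_right_comm]; exact le_mul_of_one_le_right' (one_le _))]
  refine le_inf ?_ le_rfl
  set γ := α * c.minus * (⊤ : LHat Λ).minus
  have h : α * c.minus ≤ γ := le_mul_of_one_le_right' (one_le _)
  have h' : (α : Λ) * (c 1)⁻¹ ≤ (⊤ : LHat Λ) γ := h
  calc (α : Λ) = α * (c 1)⁻¹ * c 1 := by simp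
    _ ≤ _ := mul_le_mul' h' (c.mono (one_le _))

/-- A map bounded by `c` is stationary from any `α ≥ c` on: there `θ (α * β) ≤ c ≤ α`, so truncating
at `α` changes nothing. -/
theorem exists_eq_embed_of_le {θ : LHat Λ} {c : Λ} (h : θ ≤ embed c) : ∃ t, θ = embed t := by
  obtain ⟨α, hα⟩ := exists_pos_ge c
  refine ⟨θ α, ext fun β => ?_⟩
  have h₁ : θ α = θ (α * β) := by
    rw [θ.compat (le_mul_of_one_le_right' (one_le β) : α ≤ α * β), inf_eq_left]
    exact (h _).trans (inf_le_left.trans hα)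
  rw [embed_apply, h₁]
  exact θ.compat (le_mul_of_one_le_left' (one_le α))

theorem embed_apply_one_le (θ : LHat Λ) : embed (θ 1) ≤ θ := fun α =>
  inf_le_left.trans (θ.mono (one_le α))

/-- Since `ψ` is bounded below by the element `ψ 1` of `Λ`, its inverse `θ` is bounded above by `(ψ
1)⁻¹`, and bounded elements come from `Λ`. -/
theorem exists_eq_embed_of_mul_eq_one {θ ψ : LHat Λ} (h : θ * ψ = 1) : ∃ t, θ = embed t := by
  apply exists_eq_embed_of_le (c := (ψ 1)⁻¹)
  have h₁ := LimRing.LHat_mul_mono (c := embed (ψ 1)⁻¹)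
    ((mul_le_mul_left_of_le θ (embed_apply_one_le ψ)).trans h.le)
  rwa [mul_assoc, ← embed_mul, mul_inv_cancel, embed_one, mul_one, one_mul] at h₁

end LHat

/-! ### Sections passing through given elements of `R`. -/

namespace LimRing

section approx

variable {R : Type*} [CRQSRing R]

/-- The section `φ` passes, up to truncation, through the element `x`. -/
def Approx (x : R) (φ : LimRing R) : Prop := ∃ α, x ≤ φ α

theorem Approx.mono {x y : R} {φ : LimRing R} (h : Approx y φ) (hxy : x ≤ y) : Approx x φ :=
  let ⟨α, hα⟩ := h
  ⟨α, hxy.trans hα⟩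

/-- A section has only one truncation at each level, so the level where `x` is reached does not
matter once it is at least `ep x`. -/
theorem Approx.le {x : R} {φ : LimRing R} (h : Approx x φ) {β : Pos (Lam R)}
    (hβ : ep x ≤ (β : Lam R)) : x ≤ φ β := by
  obtain ⟨α, hα⟩ := h
  have h₁ : x ≤ φ (α * β) := hα.trans (φ.mono (le_mul_of_one_le_right' (one_le β)))
  rw [φ.eq_add (le_mul_of_one_le_left' (one_le α) : β ≤ α * β), ← self_add_ep x]
  exact qadd_le_add h₁ hβ

theorem Approx.exists_le {x : R} {φ : LimRing R} (h : Approx x φ) :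
    ∃ α, ∀ β, α ≤ β → x ≤ φ β :=
  let ⟨α, hα⟩ := h
  ⟨α, fun _ hβ => hα.trans (φ.mono hβ)⟩

theorem Approx.add {x y : R} {φ ψ : LimRing R} (h : Approx x φ) (h' : Approx y ψ) :
    Approx (x + y) (φ + ψ) := by
  obtain ⟨α, hα⟩ := h.exists_le
  obtain ⟨β, hβ⟩ := h'.exists_le
  exact ⟨α * β, qadd_le_add (hα _ (le_mul_of_one_le_right' (one_le β)))
    (hβ _ (le_mul_of_one_le_left' (one_le α)))⟩

theorem Approx.neg {x : R} {φ : LimRing R} (h : Approx x φ) : Approx (-x) (-φ) :=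
  let ⟨α, hα⟩ := h
  ⟨α, qneg_le_neg hα⟩

theorem Approx.sub {x y : R} {φ ψ : LimRing R} (h : Approx x φ) (h' : Approx y ψ) :
    Approx (x + -y) (φ - ψ) := by
  rw [sub_eq_add_neg]; exact h.add h'.neg

theorem Approx.mul {x y : R} {φ ψ : LimRing R} (h : Approx x φ) (h' : Approx y ψ) :
    Approx (x * y) (φ * ψ) := by
  obtain ⟨α, hα⟩ := h.exists_le
  obtain ⟨β, hβ⟩ := h'.exists_le
  -- The product section at `η` is a pointwise product taken far out and truncated at `η`; since `ep
  -- (x * y) ≤ η`, the truncation does not cut into `x * y`.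
  obtain ⟨η, hη⟩ := LHat.exists_pos_ge (ep (x * y))
  obtain ⟨γ, hγ⟩ := mul_apply_large φ ψ η
  refine ⟨η, ?_⟩
  rw [(hγ (γ * α * β)
    ((le_mul_of_one_le_right' (one_le _)).trans (le_mul_of_one_le_right' (one_le _)))).1,
    ← self_add_ep (x * y)]
  refine qadd_le_add (qmul_le_mul (hα _ ?_) (hβ _ ?_)) hη
  · exact (le_mul_of_one_le_left' (one_le _)).trans (le_mul_of_one_le_right' (one_le _))
  · exact le_mul_of_one_le_left' (one_le _)

theorem exists_approx (hc : IsCompleteQS R) (x : R) : ∃ φ : LimRing R, Approx x φ := by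
  obtain ⟨Φ, h₁, h₂, h₃⟩ := hc x
  obtain ⟨α, hα⟩ := LHat.exists_pos_ge (ep x)
  exact ⟨⟨fun α => Φ α, fun α => h₁ α, fun α β h => h₂ α β h⟩, α, h₃ ▸ h₂ _ _ hα⟩

variable [IsDirectedQS R]

/-- Translates value bounds into incidence, so that the arithmetic of `Approx` yields value
estimates. The backward direction uses `v x ≤ x`, that is, directedness. -/
theorem approx_coe_iff {γ : Lam R} {φ : LimRing R} :
    Approx (γ : R) φ ↔ LHat.embed γ ≤ w φ := by
  constructor
  · rintro ⟨α, hα⟩ β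
    rw [(w φ).compat (le_mul_of_one_le_left' (one_le α) : β ≤ α * β)]
    refine inf_le_inf_right _ ?_
    have := v_mono (hα.trans (φ.mono (le_mul_of_one_le_right' (one_le β) : α ≤ α * β)))
    rwa [v_coe] at this
  · intro h
    obtain ⟨α, hα⟩ := LHat.exists_pos_ge γ
    refine ⟨α, le_trans (b := (v (φ α) : R)) ?_ (v_le _)⟩
    have := h α
    rwa [LHat.embed_apply, inf_eq_left.2 hα] at this

theorem Approx.v {x : R} {φ : LimRing R} (h : Approx x φ) : LHat.embed (v x) ≤ w φ :=
  approx_coe_iff.1 (h.mono (v_le x))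

end approx

/-! ### Division up to a given precision, and the modules defined by value bounds. -/

section ideal

variable {R : Type*} [CRQSRing R] [IsSuperrigid R]

/-- Multiplying by the idempotent `x * x⁻¹` can only shrink `y`. It does not, because `ep y = ep x =
v x * ep (x * x⁻¹) ≤ v y * ep (x * x⁻¹)`. -/
theorem mul_eq_of_v_le {x y : R} (he : ep x = ep y) (hv : CRQ.v x ≤ CRQ.v y) :
    x * (x⁻¹ * y) = y := by
  rw [← mul_assoc]
  refine eq_of_le (idem_mul_le y (eb_idem x)) ?_
  rw [ep_mul, v_eb, one_mul]
  refine le_inf le_rfl ?_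
  rw [← he, ep_eq x]
  exact mul_le_mul_left hv _

/-- If `ψ` has at least the value of `φ`, up to truncation at `δ`, then `ψ` is divisible by `φ`
modulo elements of value at least `δ`. -/
theorem exists_quotient (hc : IsCompleteQS R) {φ ψ : LimRing R} {δ : Lam R}
    (h : w φ ⊓ LHat.embed δ ≤ w ψ) :
    ∃ χ ∈ valuationSubring R, LHat.embed δ ≤ w (ψ - χ * φ) := by
  obtain ⟨α, hα⟩ := LHat.exists_pos_ge δ
  obtain ⟨x, hx⟩ : ∃ x, x = φ α + (δ : R) := ⟨_, rfl⟩
  obtain ⟨y, hy⟩ : ∃ y, y = ψ α + (δ : R) := ⟨_, rfl⟩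
  have ex : ep x = δ := by rw [hx, ep_add, ep_apply, ep_coe, inf_eq_right.2 hα]
  have ey : ep y = δ := by rw [hy, ep_add, ep_apply, ep_coe, inf_eq_right.2 hα]
  have hv : CRQ.v x ≤ CRQ.v y := by
    rw [hx, hy, v_add_lam, v_add_lam]
    refine le_inf ?_ inf_le_right
    have := h α
    rwa [LHat.inf_apply, LHat.embed_apply, inf_eq_left.2 hα] at this
  have hxz := mul_eq_of_v_le (ex.trans ey.symm) hv
  -- The quotient exists in `R` between the truncations at `δ`; completeness lifts it to `B`.
  obtain ⟨χ, hχ⟩ := exists_approx hc (x⁻¹ * y)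
  refine ⟨χ, ?_, ?_⟩
  · refine le_trans ?_ hχ.v
    rw [← LHat.embed_one, LHat.embed_le_embed, v_mul, v_inv, ← div_eq_inv_mul, one_le_div']
    exact hv
  · have h₁ : Approx y (χ * φ) := by
      rw [mul_comm χ φ, ← hxz]
      exact Approx.mul ⟨α, hx ▸ add_lam_le _ _⟩ hχ
    have h₂ : Approx y ψ := ⟨α, hy ▸ add_lam_le _ _⟩
    -- Both sections pass through `y`, so their difference passes through `y + -y`, which is `δ`.
    have h₃ := h₂.sub h₁
    rw [← coe_ep, ey] at h₃
    exact approx_coe_iff.1 h₃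

theorem le_w_mul {φ : LimRing R} {a : LimRing R} (ha : a ∈ valuationSubring R) :
    w φ ≤ w (a * φ) := by
  have h := LHat_mul_mono (c := w φ) (show 1 ≤ w a from ha)
  rwa [one_mul, ← w_mul] at h

/-- The submodule of the elements of value at least `γ`. -/
def valIdeal (γ : Lam R) : Submodule (valuationSubring R) (LimRing R) where
  carrier := {φ | LHat.embed γ ≤ w φ}
  add_mem' {φ ψ} (h₁ : LHat.embed γ ≤ w φ) (h₂ : LHat.embed γ ≤ w ψ) :=
    (le_inf h₁ h₂).trans (w_add φ ψ)
  zero_mem' := show LHat.embed γ ≤ w 0 by rw [w_zero]; exact le_top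
  smul_mem' a _ h := le_trans (show LHat.embed γ ≤ _ from h) (le_w_mul a.2)

theorem mem_valIdeal {γ : Lam R} {φ : LimRing R} : φ ∈ valIdeal γ ↔ LHat.embed γ ≤ w φ := Iff.rfl

theorem valIdeal_anti {γ δ : Lam R} (h : γ ≤ δ) : valIdeal δ ≤ valIdeal γ := fun _ hφ =>
  (LHat.embed_le_embed.2 h).trans hφ

/-- The new bound `η` is `w φ ⊓ δ`, which lies in `Λ` because it is bounded by `δ`. Division modulo
`valIdeal δ` gives the nontrivial inclusion. -/
theorem exists_span_singleton_sup (hc : IsCompleteQS R) (φ : LimRing R) (δ : Lam R) :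
    ∃ η, Submodule.span (valuationSubring R) {φ} ⊔ valIdeal δ = valIdeal η := by
  obtain ⟨η, hη⟩ := LHat.exists_eq_embed_of_le (inf_le_right : w φ ⊓ LHat.embed δ ≤ _)
  refine ⟨η, le_antisymm (sup_le ?_ (valIdeal_anti ?_)) fun ψ hψ => ?_⟩
  · rw [Submodule.span_singleton_le_iff_mem, mem_valIdeal, ← hη]
    exact inf_le_left
  · rw [← LHat.embed_le_embed, ← hη]; exact inf_le_right
  · rw [mem_valIdeal, ← hη] at hψ
    obtain ⟨χ, h₁, h₂⟩ := exists_quotient hc hψ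
    rw [Submodule.mem_sup]
    exact ⟨χ * φ, Submodule.mem_span_singleton.2 ⟨⟨χ, h₁⟩, rfl⟩, ψ - χ * φ, h₂, by ring⟩

theorem exists_span_sup (hc : IsCompleteQS R) (s : Finset (LimRing R)) (δ : Lam R) :
    ∃ η, Submodule.span (valuationSubring R) (s : Set (LimRing R)) ⊔ valIdeal δ =
      valIdeal η := by
  classical
  induction s using Finset.induction_on with
  | empty => exact ⟨δ, by simp⟩
  | insert φ s _ ih =>
    obtain ⟨η, hη⟩ := ih
    obtain ⟨ζ, hζ⟩ := exists_span_singleton_sup hc φ η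
    exact ⟨ζ, by rw [Finset.coe_insert, Submodule.span_insert, sup_assoc, hη, hζ]⟩

/-- Each `t` in `I B` is multiplied into `I` by all elements of large enough value; take `t = 1`. -/
theorem exists_valIdeal_le {I : Submodule (valuationSubring R) (LimRing R)} (h : I * ⊤ = ⊤) :
    ∃ b, valIdeal b ≤ I := by
  have key : ∀ t ∈ I * ⊤, ∃ b, ∀ φ ∈ valIdeal b, φ * t ∈ I := by
    intro t ht
    induction ht using Submodule.mul_induction_on' with
    | mem_mul_mem a ha ψ _ =>
      -- As `w ψ 1` bounds `w ψ` from below, this bound on `φ` puts `φ * ψ` in `A`.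
      refine ⟨(w ψ 1)⁻¹, fun φ hφ => ?_⟩
      have h₁ : φ * ψ ∈ valuationSubring R := by
        show 1 ≤ w (φ * ψ)
        have h₂ := LHat.mul_le_mul (mem_valIdeal.1 hφ) (LHat.embed_apply_one_le (w ψ))
        rwa [← LHat.embed_mul, inv_mul_cancel, ← w_mul] at h₂
      have h₂ := I.smul_mem ⟨φ * ψ, h₁⟩ ha
      rwa [show φ * (a * ψ) = φ * ψ * a by ring]
    | add x _ y _ hx hy =>
      obtain ⟨b, hb⟩ := hx
      obtain ⟨c, hc⟩ := hy
      refine ⟨b ⊔ c, fun φ hφ => ?_⟩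
      rw [mul_add]
      exact I.add_mem (hb φ (valIdeal_anti le_sup_left hφ)) (hc φ (valIdeal_anti le_sup_right hφ))
  obtain ⟨b, hb⟩ := key 1 (by rw [h]; exact Submodule.mem_top)
  exact ⟨b, fun φ hφ => by simpa using hb φ hφ⟩

end ideal

end LimRing

/-! ### The value map on finitely generated modules and the Prüfer–Manis property. -/

section value

variable {R : Type*} [CRQSRing R] [IsSuperrigid R]

open LimRing

-- Products of generators generate the product module, and multiplication in `Λ̂` distributes over
-- finite meets, including the empty meet `⊤`.
open scoped Pointwise in
theorem wHat_mul (I J : FGMod (valuationSubring R)) : wHat (I * J) = wHat I * wHat J := by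
  classical
  obtain ⟨s, hs⟩ := I.2
  obtain ⟨t, ht⟩ := J.2
  have e : Submodule.span (valuationSubring R) ((s * t : Finset (LimRing R)) : Set (LimRing R)) =
      (I * J : FGMod (valuationSubring R)) := by
    rw [Finset.coe_mul, ← Submodule.span_mul_span, hs, ht]; rfl
  have inf_mul' : ∀ (s : Finset (LimRing R)) (c : LHat (Lam R)),
      s.inf w * c = s.inf fun x => w x * c := fun s c =>
    Finset.apply_inf_eq_inf_comp (fun θ => θ * c) (fun a b => LHat.inf_mul a b c) (LHat.top_mul c)
  rw [wHat_eq _ _ e, wHat_eq _ _ hs, wHat_eq _ _ ht]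
  apply le_antisymm
  · rw [inf_mul']
    refine Finset.le_inf fun x hx => ?_
    rw [mul_comm (w x), inf_mul']
    refine Finset.le_inf fun y hy => ?_
    rw [mul_comm (w y), ← w_mul]
    exact Finset.inf_le (Finset.mul_mem_mul hx hy)
  · refine Finset.le_inf fun z hz => ?_
    obtain ⟨x, hx, y, hy, rfl⟩ := Finset.mem_mul.1 hz
    rw [w_mul]
    exact LHat.mul_le_mul (Finset.inf_le hx) (Finset.inf_le hy)

theorem wHat_one : wHat (1 : FGMod (valuationSubring R)) = 1 := by
  rw [wHat_eq 1 {1} (by rw [Finset.coe_singleton, ← Submodule.one_eq_span]; rfl),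
    Finset.inf_singleton, w_one]

theorem wHat_le_w {I : FGMod (valuationSubring R)} {φ : LimRing R}
    (h : φ ∈ (I : Submodule (valuationSubring R) (LimRing R))) : wHat I ≤ w φ := by
  obtain ⟨s, hs⟩ := I.2
  rw [wHat_eq I s hs]
  exact inf_w_le s (hs ▸ h)

theorem le_wHat {I : FGMod (valuationSubring R)} {θ : LHat (Lam R)}
    (h : ∀ φ ∈ (I : Submodule (valuationSubring R) (LimRing R)), θ ≤ w φ) : θ ≤ wHat I := by
  obtain ⟨s, hs⟩ := I.2
  rw [wHat_eq I s hs]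
  exact Finset.le_inf fun φ hφ => h φ (hs ▸ Submodule.subset_span hφ)

theorem wHat_mul_wHat_inv (I : (FGMod (valuationSubring R))ˣ) :
    wHat (I : FGMod (valuationSubring R)) * wHat (I⁻¹ : (FGMod (valuationSubring R))ˣ) = 1 := by
  rw [← wHat_mul, Units.mul_inv, wHat_one]

/-- An invertible module of value `γ` consists of all elements of value at least `γ`. -/
theorem coe_unit_eq_valIdeal {I : (FGMod (valuationSubring R))ˣ} {γ : Lam R}
    (h : wHat (I : FGMod (valuationSubring R)) = LHat.embed γ) :
    ((I : FGMod (valuationSubring R)) : Submodule (valuationSubring R) (LimRing R)) =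
      valIdeal γ := by
  refine le_antisymm (fun φ hφ => h.symm.le.trans (wHat_le_w hφ)) fun φ hφ => ?_
  rw [mem_valIdeal, ← h] at hφ
  -- The product of `φ` with any element of `I⁻¹` lies in `A`, so `φ` multiplies `I⁻¹ I` into `I`;
  -- and `I⁻¹ I` contains `1`.
  have key : ∀ t ∈ (((I⁻¹ : (FGMod (valuationSubring R))ˣ) : FGMod (valuationSubring R)) :
      Submodule (valuationSubring R) (LimRing R)) * (I : FGMod (valuationSubring R)),
      φ * t ∈ ((I : FGMod (valuationSubring R)) :
        Submodule (valuationSubring R) (LimRing R)) := by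
    intro t ht
    induction ht using Submodule.mul_induction_on' with
    | mem_mul_mem χ hχ η hη =>
      have h₁ : φ * χ ∈ valuationSubring R := by
        show 1 ≤ w (φ * χ)
        rw [w_mul, ← wHat_mul_wHat_inv I]
        exact LHat.mul_le_mul hφ (wHat_le_w hχ)
      rw [← mul_assoc]
      exact Submodule.smul_mem _ ⟨φ * χ, h₁⟩ hη
    | add x _ y _ hx hy => rw [mul_add]; exact Submodule.add_mem _ hx hy
  have e : (((I⁻¹ : (FGMod (valuationSubring R))ˣ) : FGMod (valuationSubring R)) :
      Submodule (valuationSubring R) (LimRing R)) * (I : FGMod (valuationSubring R)) = 1 :=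
    congrArg Subtype.val (Units.inv_mul I)
  have := key 1 (by rw [e]; exact Submodule.one_le.1 le_rfl)
  rwa [mul_one] at this

theorem exists_wHat_eq_embed (I : (FGMod (valuationSubring R))ˣ) :
    ∃ γ, wHat (I : FGMod (valuationSubring R)) = LHat.embed γ :=
  LHat.exists_eq_embed_of_mul_eq_one (wHat_mul_wHat_inv I)

/-- In general `γ` need not be the meet of the values on `valIdeal γ`. Here it is, since this module
is an invertible module of value `γ`. -/
theorem valIdeal_le_iff
    (honto : ∀ γ : Lam R, ∃ I : (FGMod (valuationSubring R))ˣ,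
      wHat (I : FGMod (valuationSubring R)) = LHat.embed γ) {γ δ : Lam R} :
    valIdeal γ ≤ valIdeal δ ↔ δ ≤ γ := by
  refine ⟨fun h => ?_, valIdeal_anti⟩
  obtain ⟨I, hI⟩ := honto γ
  rw [← LHat.embed_le_embed, ← hI]
  exact le_wHat fun φ hφ => h (coe_unit_eq_valIdeal hI ▸ hφ)

/-- Being finitely generated, `valIdeal γ` plus `valIdeal δ` is some `valIdeal η`. It contains both
summands, which forces `η ≤ γ ⊓ δ`. -/
theorem valIdeal_sup (hc : IsCompleteQS R)
    (honto : ∀ γ : Lam R, ∃ I : (FGMod (valuationSubring R))ˣ,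
      wHat (I : FGMod (valuationSubring R)) = LHat.embed γ) (γ δ : Lam R) :
    valIdeal γ ⊔ valIdeal δ = valIdeal (γ ⊓ δ) := by
  obtain ⟨I, hI⟩ := honto γ
  obtain ⟨s, hs⟩ := (I : FGMod (valuationSubring R)).2
  obtain ⟨η, hη⟩ := exists_span_sup hc s δ
  rw [hs, coe_unit_eq_valIdeal hI] at hη
  refine le_antisymm (sup_le (valIdeal_anti inf_le_left) (valIdeal_anti inf_le_right)) ?_
  rw [hη]
  refine valIdeal_anti (le_inf ?_ ?_)
  · rw [← valIdeal_le_iff honto, ← hη]; exact le_sup_left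
  · rw [← valIdeal_le_iff honto, ← hη]; exact le_sup_right

theorem isPruferQS (hc : IsCompleteQS R)
    (honto : ∀ γ : Lam R, ∃ I : (FGMod (valuationSubring R))ˣ,
      wHat (I : FGMod (valuationSubring R)) = LHat.embed γ) : IsPruferQS R := by
  intro I h
  obtain ⟨b, hb⟩ := exists_valIdeal_le h
  obtain ⟨s, hs⟩ := I.2
  obtain ⟨η, hη⟩ := exists_span_sup hc s b
  obtain ⟨J, hJ⟩ := honto η
  rw [hs, sup_eq_left.2 hb, ← coe_unit_eq_valIdeal hJ] at hη
  exact ⟨J, (Subtype.ext hη).symm⟩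

theorem valueUnits_eq
    (honto : ∀ γ : Lam R, ∃ I : (FGMod (valuationSubring R))ˣ,
      wHat (I : FGMod (valuationSubring R)) = LHat.embed γ) :
    valueUnits R = Set.range (LHat.embed : Lam R → LHat (Lam R)) := by
  ext θ
  constructor
  · rintro ⟨-, ψ, -, h⟩
    obtain ⟨t, ht⟩ := LHat.exists_eq_embed_of_mul_eq_one h
    exact ⟨t, ht.symm⟩
  · rintro ⟨γ, rfl⟩
    obtain ⟨I, hI⟩ := honto γ
    exact ⟨⟨I, hI⟩, _, ⟨_, rfl⟩, hI ▸ wHat_mul_wHat_inv I⟩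

theorem isStronglyPruferManis (hc : IsCompleteQS R)
    (honto : ∀ γ : Lam R, ∃ I : (FGMod (valuationSubring R))ˣ,
      wHat (I : FGMod (valuationSubring R)) = LHat.embed γ) : IsStronglyPruferManis R := by
  refine ⟨isPruferQS hc honto, valueUnits_eq honto, ?_⟩
  choose f hf using exists_wHat_eq_embed (R := R)
  choose g hg using honto
  have hfg : ∀ γ, f (g γ) = γ := fun γ => LHat.embed_injective ((hf _).symm.trans (hg γ))
  have hord : ∀ I J : (FGMod (valuationSubring R))ˣ, f I ≤ f J ↔
      ((J : FGMod (valuationSubring R)) : Submodule (valuationSubring R) (LimRing R)) ≤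
        (I : FGMod (valuationSubring R)) := fun I J => by
    rw [coe_unit_eq_valIdeal (hf I), coe_unit_eq_valIdeal (hf J),
      valIdeal_le_iff fun γ => ⟨g γ, hg γ⟩]
  have left_inv : Function.LeftInverse g f := fun I => by
    apply Units.ext
    apply Subtype.ext
    rw [coe_unit_eq_valIdeal (hg _), coe_unit_eq_valIdeal (hf I)]
  have map_mul : ∀ I J, f (I * J) = f I * f J := fun I J => by
    apply LHat.embed_injective
    rw [← hf, Units.val_mul, wHat_mul, hf, hf, LHat.embed_mul]
  exact ⟨⟨⟨f, g, left_inv, hfg⟩, map_mul⟩, hf, hord⟩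

end value

/-! ### Computations in Abelian lattice-ordered groups. -/

section lattice

variable {Λ : Type*} [CommGroup Λ] [Lattice Λ] [IsOrderedMonoid Λ]

theorem lattice_group_inf_sup_left (a b c : Λ) : a ⊓ (b ⊔ c) = a ⊓ b ⊔ a ⊓ c :=
  letI := CommGroup.toDistribLattice Λ
  inf_sup_left a b c

/-- Each of `a`, `b`, `c` lies below the join of the other two, so by distributivity it is the join
of its meets with them. Used for the uniqueness of medians. -/
theorem le_of_pairwise_sup {a b c u : Λ} (h₁ : u = a ⊔ b) (h₂ : u = b ⊔ c) (h₃ : u = c ⊔ a) :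
    u ≤ a ⊓ b ⊔ (b ⊓ c ⊔ c ⊓ a) := by
  have ha : a ≤ a ⊓ b ⊔ a ⊓ c := by
    rw [← lattice_group_inf_sup_left, ← h₂, h₁]; exact le_inf le_rfl le_sup_left
  have hb : b ≤ b ⊓ c ⊔ b ⊓ a := by
    rw [← lattice_group_inf_sup_left, ← h₃, h₁]; exact le_inf le_rfl le_sup_right
  rw [h₁]
  refine sup_le (ha.trans (sup_le le_sup_left ?_)) (hb.trans (sup_le ?_ ?_))
  · rw [inf_comm]; exact le_sup_right.trans le_sup_right
  · exact le_sup_left.trans le_sup_right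
  · rw [inf_comm]; exact le_sup_left

/-- Recovers `π` from the distance `ξ / π * (κ / μ)`: factoring out `ξ / π` leaves `(κ / μ) ⊓ (π /
μ) = 1`. -/
theorem inf_eq_div {μ ξ π κ : Λ} (h : π ⊓ κ = μ) : ξ / π * (κ / μ) ⊓ (ξ / μ) = ξ / π := by
  rw [show ξ / μ = ξ / π * (π / μ) by simp, ← mul_inf, div_eq_mul_inv κ,
    div_eq_mul_inv π, ← inf_mul, inf_comm, h]
  simp

theorem eq_of_div_mul_div_eq {μ ξ π κ π' κ' : Λ} (h : π ⊓ κ = μ) (h' : π' ⊓ κ' = μ)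
    (he : ξ / π * (κ / μ) = ξ / π' * (κ' / μ)) : π = π' ∧ κ = κ' := by
  have e : π = π' := by
    have := inf_eq_div (ξ := ξ) h
    rw [he, inf_eq_div h'] at this
    simpa using this.symm
  subst e
  simpa using he

theorem exists_div_mul_div_eq {μ ξ η γ : Λ} (hγ : 1 ≤ γ) (hξ : μ ≤ ξ) (hη : μ ≤ η)
    (hγ' : γ ≤ ξ / μ * (η / μ)) :
    ∃ π κ : Λ, π ≤ ξ ∧ κ ≤ η ∧ π ⊓ κ = μ ∧ ξ / π * (κ / μ) = γ := by
  obtain ⟨a, rfl⟩ : ∃ a, ξ = a * μ := ⟨ξ / μ, by simp⟩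
  obtain ⟨b, rfl⟩ : ∃ b, η = b * μ := ⟨η / μ, by simp⟩
  simp only [mul_div_cancel_right] at hγ'
  have ha : 1 ≤ a := by simpa using hξ
  have hb : 1 ≤ b := by simpa using hη
  -- Riesz decomposition of `γ ≤ a * b`: the factor `γ ⊓ a` is spent on descending from `ξ`, the
  -- rest `γ / (γ ⊓ a) ≤ b` on ascending from `μ`.
  refine ⟨a * μ / (γ ⊓ a), γ * μ / (γ ⊓ a), (div_le_self_iff _).2 (le_inf hγ ha), ?_, ?_, ?_⟩
  · rw [div_le_iff_le_mul, mul_right_comm]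
    refine mul_le_mul_left ?_ _
    rw [mul_inf]
    exact le_inf (le_mul_of_one_le_left' hb) (by rwa [mul_comm])
  · rw [div_eq_mul_inv, div_eq_mul_inv, ← inf_mul, ← inf_mul, inf_comm a, mul_right_comm]
    simp
  · rw [div_div_cancel, div_right_comm, mul_div_cancel_right, mul_div_cancel]

end lattice

/-! ### Joins in `R` and their effect on `ep`. -/

namespace LimRing
section join

variable {R : Type*} [CRQSRing R]

/-- The meet `z ⊓ z'` is still above `x` and `y`, so its `ep` is already as large as that of `z` and
`z'`. -/
theorem eq_of_le_of_ep_eq_sup {x y z z' : R} (hx : x ≤ z) (hy : y ≤ z) (hx' : x ≤ z')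
    (hy' : y ≤ z') (he : ep z = ep x ⊔ ep y) (he' : ep z' = ep x ⊔ ep y) [IsDirectedQS R] :
    z = z' := by
  have h₁ : ∀ t : R, t ≤ z → t ≤ z' → ep t ≤ ep (z ⊓ z') := fun t h h' => ep_mono (le_inf h h')
  have h₂ : ep x ⊔ ep y ≤ ep (z ⊓ z') := sup_le (h₁ x hx hx') (h₁ y hy hy')
  exact (eq_of_le inf_le_left (he.le.trans h₂)).symm.trans
    (eq_of_le inf_le_right (he'.le.trans h₂))

theorem le_add_coe {x z : R} {α : Lam R} (h : x ≤ z) (hα : ep x ≤ α) : x ≤ z + (α : R) := by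
  rw [← self_add_ep x]
  exact qadd_le_add h hα

/-- Truncating a least upper bound at `ep x ⊔ ep y` leaves an upper bound, so nothing is cut off. -/
theorem ep_of_isLUB {x y z : R} (h : IsLUB {x, y} z) : ep z = ep x ⊔ ep y := by
  have hx : x ≤ z := h.1 (Set.mem_insert _ _)
  have hy : y ≤ z := h.1 (Set.mem_insert_of_mem _ rfl)
  apply le_antisymm
  · have : z ≤ z + ((ep x ⊔ ep y : Lam R) : R) := h.2 (by
      rintro _ (rfl | rfl)
      exacts [le_add_coe hx le_sup_left, le_add_coe hy le_sup_right])
    refine (ep_mono this).trans ?_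
    rw [ep_add, ep_coe]; exact inf_le_right
  · exact sup_le (ep_mono hx) (ep_mono hy)

variable [IsDirectedQS R]

/-- Two elements with an upper bound have a join, obtained by truncating the upper bound. -/
theorem isLUB_of_ep_eq_sup {x y z : R} (hx : x ≤ z) (hy : y ≤ z) (he : ep z = ep x ⊔ ep y) :
    IsLUB {x, y} z := by
  refine ⟨?_, fun t ht => ?_⟩
  · rintro _ (rfl | rfl)
    exacts [hx, hy]
  · have hxt : x ≤ t := ht (Set.mem_insert _ _)
    have hyt : y ≤ t := ht (Set.mem_insert_of_mem _ rfl)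
    have e : z = t + ((ep x ⊔ ep y : Lam R) : R) :=
      eq_of_le_of_ep_eq_sup hx hy (le_add_coe hxt le_sup_left) (le_add_coe hyt le_sup_right) he
        (by rw [ep_add, ep_coe, inf_eq_right]; exact sup_le (ep_mono hxt) (ep_mono hyt))
    rw [e]; exact add_lam_le _ _

theorem v_sub_eq_ep_inf (x y : R) : v (x + -y) = ep (x ⊓ y) := by
  rw [inf_def, ep_add, ep_coe, eq_comm, inf_eq_right]
  refine (v_le_ep _).trans ?_
  rw [ep_add]; exact inf_le_left

end join

/-! ### Cells, distances and medians. -/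

section metric

variable {R : Type*} [CRQSRing R]

theorem add_coe_eq_of_le {p x : R} (h : p ≤ x) : x + (ep p : R) = p := (le_iff.1 h).symm

/-- Below a common bound, `x` truncated at `ep y` and `y` truncated at `ep x` are the same
truncation of `z`, hence a lower bound of both. -/
theorem ep_inf_of_le [IsDirectedQS R] {x y z : R} (hx : x ≤ z) (hy : y ≤ z) :
    ep (x ⊓ y) = ep x ⊓ ep y := by
  apply le_antisymm (le_inf (ep_mono inf_le_left) (ep_mono inf_le_right))
  have e : x + (ep y : R) = y + (ep x : R) := by
    rw [← add_coe_eq_of_le hx, ← add_coe_eq_of_le hy, ep_add, ep_add, ep_coe, ep_coe,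
      inf_eq_right.2 (ep_mono hx), inf_eq_right.2 (ep_mono hy)]
    ac_rfl
  have := ep_mono (le_inf (add_lam_le x (ep y)) (e ▸ add_lam_le y (ep x)))
  rwa [ep_add, ep_coe] at this

/-- Any two elements have a join with the expected `e⁺` as soon as their meet has the expected
`e⁺`. -/
def HasJoins (R : Type*) [CRQSRing R] [IsDirectedQS R] : Prop :=
  ∀ x y : R, ep x ⊓ ep y ≤ ep (x ⊓ y) → ∃ z, x ≤ z ∧ y ≤ z ∧ ep z = ep x ⊔ ep y

section directed

variable [IsDirectedQS R]

theorem inf_inf_inf_eq_of_mem_cell {x y z : R} (h : z ∈ cell x y) :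
    (x ⊓ z) ⊓ (y ⊓ z) = x ⊓ y := by
  rw [inf_inf_inf_comm, inf_idem, inf_eq_left.2 h.1]

theorem ep_inf_ep_of_mem_cell {x y z : R} (h : z ∈ cell x y) :
    ep (x ⊓ z) ⊓ ep (y ⊓ z) = ep (x ⊓ y) := by
  rw [← ep_inf_of_le inf_le_right inf_le_right, inf_inf_inf_eq_of_mem_cell h]

/-- As `z` is the join of `x ⊓ z` and `y ⊓ z`, the identity `(a ⊓ b) * (a ⊔ b) = a * b` eliminates
`ep z`. -/
theorem qdist_of_mem_cell {x y z : R} (h : z ∈ cell x y) :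
    qdist x z = ep x / ep (x ⊓ z) * (ep (y ⊓ z) / ep (x ⊓ y)) := by
  have h₁ := inf_mul_sup (ep (x ⊓ z)) (ep (y ⊓ z))
  rw [← ep_of_isLUB h.2, ep_inf_ep_of_mem_cell h] at h₁
  rw [qdist, ← mul_right_inj (ep (x ⊓ y)), ← mul_div_assoc, mul_left_comm, h₁,
    ← mul_div_assoc, mul_div_cancel, sq, mul_left_comm, mul_div_mul_left_eq_div, div_mul_eq_mul_div]

theorem qdist_eq (x y : R) : qdist x y = ep x / ep (x ⊓ y) * (ep y / ep (x ⊓ y)) := by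
  rw [qdist, div_mul_div_comm, sq]

/-- The point is the join of the truncations of `x` at `π` and of `y` at `κ`; these are compatible
because both contain `x ⊓ y`. -/
theorem exists_mem_cell (hj : HasJoins R) {x y : R} {π κ : Lam R} (hπ : π ≤ ep x)
    (hκ : κ ≤ ep y) (h : π ⊓ κ = ep (x ⊓ y)) :
    ∃ z ∈ cell x y, ep (x ⊓ z) = π ∧ ep (y ⊓ z) = κ := by
  have eπ : ep (x + (π : R)) = π := by rw [ep_add, ep_coe, inf_eq_right.2 hπ]
  have eκ : ep (y + (κ : R)) = κ := by rw [ep_add, ep_coe, inf_eq_right.2 hκ]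
  have hμπ : ep (x ⊓ y) ≤ π := h ▸ inf_le_left
  have hμκ : ep (x ⊓ y) ≤ κ := h ▸ inf_le_right
  obtain ⟨z, h₁, h₂, h₃⟩ := hj (x + (π : R)) (y + (κ : R)) (by
    rw [eπ, eκ, h]
    exact ep_mono (le_inf (le_add_coe inf_le_left hμπ) (le_add_coe inf_le_right hμκ)))
  rw [eπ, eκ] at h₃
  have key : ∀ {x y : R} {π κ : Lam R}, π ⊓ κ = ep (x ⊓ y) → ep (x + (π : R)) = π →
      ep (y + (κ : R)) = κ → x + (π : R) ≤ z → y + (κ : R) ≤ z → ep z = π ⊔ κ →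
      x + (π : R) = x ⊓ z := by
    intro x y π κ h eπ eκ h₁ h₂ h₃
    refine eq_of_le (le_inf (add_lam_le _ _) h₁) ?_
    -- By distributivity, `ep (x ⊓ z)` splits into its meets with `π` and `κ`. The second is the
    -- `ep` of an element below `x ⊓ y`, so it is at most `π` too.
    rw [eπ, ← inf_eq_left.2 (ep_mono (inf_le_right : x ⊓ z ≤ z)), h₃, lattice_group_inf_sup_left]
    refine sup_le inf_le_right ?_
    have h₄ := ep_inf_of_le (inf_le_right : x ⊓ z ≤ z) h₂
    rw [eκ] at h₄
    rw [← h₄]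
    refine (ep_mono (le_inf (inf_le_left.trans inf_le_left)
      (inf_le_right.trans (add_lam_le _ _)))).trans ?_
    rw [← h]; exact inf_le_left
  have k₁ := key h eπ eκ h₁ h₂ h₃
  have k₂ := key (by rw [inf_comm, h, inf_comm]) eκ eπ h₂ h₁ (by rw [h₃, sup_comm])
  refine ⟨z, ⟨(le_add_coe inf_le_left hμπ).trans h₁, ?_⟩, k₁ ▸ eπ, k₂ ▸ eκ⟩
  rw [← k₁, ← k₂]
  exact isLUB_of_ep_eq_sup h₁ h₂ (by rw [h₃, eπ, eκ])

theorem isLFF_of_hasJoins (hj : HasJoins R) : IsLFF R := by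
  intro x y
  refine ⟨fun z hz => ?_, fun z hz z' hz' h => ?_, fun γ hγ => ?_⟩
  · have h := ep_inf_ep_of_mem_cell hz
    rw [Set.mem_Icc, qdist_of_mem_cell hz, qdist_eq]
    refine ⟨one_le_mul (one_le_div'.2 (ep_mono inf_le_left)) (one_le_div'.2 ?_), mul_le_mul'
      (div_le_div_left' ?_ _) (div_le_div_right' (ep_mono inf_le_left) _)⟩
    · rw [← h]; exact inf_le_right
    · rw [← h]; exact inf_le_left
  · rw [qdist_of_mem_cell hz, qdist_of_mem_cell hz'] at h
    obtain ⟨e₁, e₂⟩ := eq_of_div_mul_div_eq (ep_inf_ep_of_mem_cell hz)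
      (ep_inf_ep_of_mem_cell hz') h
    -- An element below `x` is the truncation of `x` at its own `ep`. So the pair of values fixes
    -- both meets, and `z` is their join.
    have k : ∀ {x : R}, ep (x ⊓ z) = ep (x ⊓ z') → x ⊓ z = x ⊓ z' := fun {x} e => by
      rw [← add_coe_eq_of_le (inf_le_left : x ⊓ z ≤ x), e, add_coe_eq_of_le inf_le_left]
    have l := hz.2
    rw [k e₁, k e₂] at l
    exact l.unique hz'.2
  · rw [Set.mem_Icc, qdist_eq] at hγ
    obtain ⟨π, κ, h₁, h₂, h₃, h₄⟩ := exists_div_mul_div_eq hγ.1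
      (ep_mono (inf_le_left : x ⊓ y ≤ x)) (ep_mono (inf_le_right : x ⊓ y ≤ y)) hγ.2
    obtain ⟨z, hz, rfl, rfl⟩ := exists_mem_cell hj h₁ h₂ h₃
    exact ⟨z, hz, (qdist_of_mem_cell hz).trans h₄⟩

/-- The three pairwise meets of three elements have a join. -/
theorem exists_join_of_meets (hj : HasJoins R) (x y z : R) :
    ∃ u, x ⊓ y ≤ u ∧ y ⊓ z ≤ u ∧ z ⊓ x ≤ u ∧
      (∀ t, x ⊓ y ≤ t → y ⊓ z ≤ t → z ⊓ x ≤ t → u ≤ t) ∧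
      ep u = ep (x ⊓ y) ⊔ (ep (y ⊓ z) ⊔ ep (z ⊓ x)) := by
  obtain ⟨a, ha⟩ : ∃ a, a = x ⊓ y := ⟨_, rfl⟩
  obtain ⟨b, hb⟩ : ∃ b, b = y ⊓ z := ⟨_, rfl⟩
  obtain ⟨c, hc⟩ : ∃ c, c = z ⊓ x := ⟨_, rfl⟩
  rw [← ha, ← hb, ← hc]
  -- Any two of the three meets share an upper bound among `x`, `y`, `z`, hence are compatible;
  -- distributivity carries this over to `a` and the join `j`.
  obtain ⟨j, h₁, h₂, h₃⟩ := hj b c (ep_inf_of_le (z := z) (hb ▸ inf_le_right)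
    (hc ▸ inf_le_left)).ge
  have lj := isLUB_of_ep_eq_sup h₁ h₂ h₃
  obtain ⟨u, k₁, k₂, k₃⟩ := hj a j (by
    rw [h₃, lattice_group_inf_sup_left]
    refine sup_le ?_ ?_
    · rw [← ep_inf_of_le (z := y) (ha ▸ inf_le_right) (hb ▸ inf_le_left)]
      exact ep_mono (le_inf inf_le_left (inf_le_right.trans h₁))
    · rw [← ep_inf_of_le (z := x) (ha ▸ inf_le_left) (hc ▸ inf_le_right)]
      exact ep_mono (le_inf inf_le_left (inf_le_right.trans h₂)))
  refine ⟨u, k₁, h₁.trans k₂, h₂.trans k₂, fun t ta tb tc => ?_, by rw [k₃, h₃]⟩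
  refine (isLUB_of_ep_eq_sup k₁ k₂ k₃).2 ?_
  rintro _ (rfl | rfl)
  · exact ta
  · refine lj.2 ?_
    rintro _ (rfl | rfl)
    exacts [tb, tc]

theorem isMedianQS_of_hasJoins (hj : HasJoins R) : IsMedianQS R := by
  intro x y z
  obtain ⟨u, h₁, h₂, h₃, hu, eu⟩ := exists_join_of_meets hj x y z
  refine ⟨u, ⟨⟨⟨h₁, ?_⟩, ⟨h₂, ?_⟩⟩, ⟨h₃, ?_⟩⟩, ?_⟩
  · refine ⟨?_, fun t ht => hu t ?_ ?_ ?_⟩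
    · rintro _ (rfl | rfl) <;> exact inf_le_right
    · exact le_trans (le_inf inf_le_left h₁) (ht (Or.inl rfl))
    · exact le_trans (le_inf inf_le_left h₂) (ht (Or.inr rfl))
    · exact le_trans (le_inf inf_le_right h₃) (ht (Or.inl rfl))
  · refine ⟨?_, fun t ht => hu t ?_ ?_ ?_⟩
    · rintro _ (rfl | rfl) <;> exact inf_le_right
    · exact le_trans (le_inf inf_le_right h₁) (ht (Or.inl rfl))
    · exact le_trans (le_inf inf_le_left h₂) (ht (Or.inl rfl))
    · exact le_trans (le_inf inf_le_left h₃) (ht (Or.inr rfl))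
  · refine ⟨?_, fun t ht => hu t ?_ ?_ ?_⟩
    · rintro _ (rfl | rfl) <;> exact inf_le_right
    · exact le_trans (le_inf inf_le_left h₁) (ht (Or.inr rfl))
    · exact le_trans (le_inf inf_le_right h₂) (ht (Or.inl rfl))
    · exact le_trans (le_inf inf_le_left h₃) (ht (Or.inl rfl))
  · rintro t ⟨⟨hxy, hyz⟩, hzx⟩
    -- Any median `t` lies above `u`, so it suffices to compare `ep`. Membership in the cells makes
    -- `ep t` the join of any two of `ep (x ⊓ t)`, `ep (y ⊓ t)`, `ep (z ⊓ t)`.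
    refine (eq_of_le (hu t hxy.1 hyz.1 hzx.1) ?_).symm
    rw [eu, ← ep_inf_ep_of_mem_cell hxy, ← ep_inf_ep_of_mem_cell hyz, ← ep_inf_ep_of_mem_cell hzx]
    exact le_of_pairwise_sup (ep_of_isLUB hxy.2) (ep_of_isLUB hyz.2) (ep_of_isLUB hzx.2)

end directed

/-- Chinese remainder argument: lifts of `x` and `y` differ by an element of value at least `ep x ⊓
ep y`, which splits into corrections invisible at `x` and at `y` respectively. -/
theorem hasJoins_of_valIdeal_sup [IsSuperrigid R] (hc : IsCompleteQS R)
    (hs : ∀ γ δ : Lam R, valIdeal γ ⊔ valIdeal δ = valIdeal (γ ⊓ δ)) : HasJoins R := by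
  intro x y h
  obtain ⟨φ, hφ⟩ := exists_approx hc x
  obtain ⟨ψ, hψ⟩ := exists_approx hc y
  have h₁ : φ - ψ ∈ valIdeal (ep x ⊓ ep y) := by
    refine valIdeal_anti h ?_
    rw [← v_sub_eq_ep_inf]
    exact (hφ.sub hψ).v
  rw [← hs, Submodule.mem_sup] at h₁
  obtain ⟨a, ha, b, hb, hab⟩ := h₁
  have k₁ : Approx x (φ - a) := by
    have := hφ.sub (approx_coe_iff.2 ha)
    rwa [neg_of_idem (ep x).2, self_add_ep] at this
  have k₂ : Approx y (φ - a) := by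
    have := hψ.add (approx_coe_iff.2 hb)
    rw [self_add_ep] at this
    rwa [show φ - a = ψ + b by rw [sub_eq_iff_eq_add, add_assoc, add_comm b, hab]; abel]
  obtain ⟨α, hα⟩ := LHat.exists_pos_ge (ep x ⊔ ep y)
  refine ⟨(φ - a) α + ((ep x ⊔ ep y : Lam R) : R), le_add_coe (k₁.le (le_sup_left.trans hα))
    le_sup_left, le_add_coe (k₂.le (le_sup_right.trans hα)) le_sup_right, ?_⟩
  rw [ep_add, ep_coe, ep_apply, inf_eq_right.2 hα]

end metric
end LimRing
end CRQ

theorem lemma6p11 (R : Type*) [CRQ.CRQSRing R] [CRQ.IsSuperrigid R]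
    (hcomplete : CRQ.IsCompleteQS R)
    (honto : ∀ γ : CRQ.Lam R, ∃ I : (CRQ.FGMod (CRQ.LimRing.valuationSubring R))ˣ,
      CRQ.wHat (I : CRQ.FGMod (CRQ.LimRing.valuationSubring R)) = CRQ.LHat.embed γ) :
    CRQ.IsStronglyPruferManis R ∧ CRQ.IsLFF R ∧ CRQ.IsMedianQS R :=
  have hj := CRQ.LimRing.hasJoins_of_valIdeal_sup hcomplete (CRQ.valIdeal_sup hcomplete honto)
  ⟨CRQ.isStronglyPruferManis hcomplete honto, CRQ.LimRing.isLFF_of_hasJoins hj,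
    CRQ.LimRing.isMedianQS_of_hasJoins hj⟩
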